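/- A function $F$ is in the Selberg class $\mathcal S$ if it satisfies the following conditions, where $s=\sigma+it$. (i) For $\sigma>1$, $F(s)=\sum_{n\ge1}a(n)n^{-s}$ with an absolutely convergent series. (ii) $F$ continues to a meromorphic function on $\mathbb C$ such that $(s-1)^mF(s)$ is entire of finite order for some integer $m\ge0$. (iii) There are $r\ge0$, $Q>0$, $\lambda_1,\dots,\lambda_r>0$, $\mu_1,\dots,\mu_r\in\mathbb C$ with $\Re\mu_j\ge0$, and $\omega\in\mathbb C$ with $|\omega|=1$ such that, as meromorphic functions, $$Q^s\prod_{j=1}^r\Gamma(\lambda_js+\mu_j)F(s)=\omega Q^{1-s}\prod_{j=1}^r\Gamma(\lambda_j(1-s)+\overline{\mu_j})\,\overline{F(1-\overline s)}.$$ (iv) For every $\varepsilon>0$, $a(n)\ll_\varepsilon n^\varepsilon$. (v) For $\sigma>1$, $\log F(s)=\sum_{n\ge1}b(n)n^{-s}$ with an absolutely convergent series, where $b(n)=0$ unless $n=p^k$ with $p$ prime and $k\ge1$, and $b(n)\ll n^\theta$ for some $\theta<1/2$. **Theorem 3.** Let $F,G\in\mathcal S$ and suppose that there is a constant $C$ such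 that $|F(s)|\le C|G(s)|$ for all $s\neq1$ with $\sigma>1/2$. Then $F(s)=G(s)$ identically, i.e. for all $s\ne1$ (the point $s=1$ is left out only because $F$ and $G$ may have a pole there; where they are holomorphic there, their values at $1$ agree by continuity). -/

import Mathlib

namespace Selberg

/-- An entire function of finite order: holomorphic on `ℂ` and `E(s) = O(exp (|s| ^ A))`
for some `A ≥ 0`. -/
def IsEntireOfFiniteOrder (E : ℂ → ℂ) : Prop :=
  Differentiable ℂ E ∧
    ∃ A C : ℝ, 0 ≤ A ∧ ∀ s : ℂ, ‖E s‖ ≤ C * Real.exp (‖s‖ ^ A)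

/-- `F` is represented, for `Re s > 1`, by the absolutely convergent Dirichlet series
`∑ a(n) n^{-s}` (over `n ≥ 1`; the value `a 0` plays no role).
Summability in `ℂ` is absolute summability. -/
def IsDirichletSeriesOf (a : ℕ → ℂ) (F : ℂ → ℂ) : Prop :=
  ∀ s : ℂ, 1 < s.re → LSeriesHasSum a s (F s)

/-- The Ramanujan condition: `a(n) ≪ n^ε` for every `ε > 0`. -/
def RamanujanCondition (a : ℕ → ℂ) : Prop :=
  ∀ ε : ℝ, 0 < ε → ∃ C : ℝ, ∀ n : ℕ, 1 ≤ n → ‖a n‖ ≤ C * (n : ℝ) ^ ε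

/-- For some integer `m ≥ 0` the function `(s - 1)^m F(s)` is (after filling in the point `s = 1`)
entire of finite order. The value of `F` at its only possible pole `s = 1` is irrelevant. -/
def HasContinuation (F : ℂ → ℂ) : Prop :=
  ∃ (m : ℕ) (E : ℂ → ℂ), IsEntireOfFiniteOrder E ∧
    ∀ s : ℂ, s ≠ 1 → (s - 1) ^ m * F s = E s

/-- The factor `Q^s ∏_j Γ(lam_j s + mu_j)`. -/
noncomputable def gammaFactor {r : ℕ} (Q : ℝ) (lam : Fin r → ℝ) (mu : Fin r → ℂ) (s : ℂ) : ℂ :=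
  (Q : ℂ) ^ s * ∏ j, Complex.Gamma ((lam j : ℂ) * s + mu j)

/-- `s` is not a pole of any of the functions `Γ(lam_j s + mu_j)`. -/
def GammaRegular {r : ℕ} (lam : Fin r → ℝ) (mu : Fin r → ℂ) (s : ℂ) : Prop :=
  ∀ (j : Fin r) (k : ℕ), (lam j : ℂ) * s + mu j ≠ -(k : ℂ)

/-- Functional equation of Riemann type
`Q^s ∏ Γ(lam_j s + mu_j) F(s) = ω Q^{1-s} ∏ Γ(lam_j (1-s) + conj mu_j) conj (F(1 - conj s))`
with `r ≥ 0`, `Q > 0`, `lam_j > 0`, `Re mu_j ≥ 0`, `|ω| = 1`. It is an identity of meromorphic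
functions, stated at all the points where every function in it is regular. -/
def HasFunctionalEquation (F : ℂ → ℂ) : Prop :=
  ∃ (r : ℕ) (Q : ℝ) (lam : Fin r → ℝ) (mu : Fin r → ℂ) (ω : ℂ),
    0 < Q ∧ (∀ j, 0 < lam j) ∧ (∀ j, 0 ≤ (mu j).re) ∧ ‖ω‖ = 1 ∧
    ∀ s : ℂ, s ≠ 0 → s ≠ 1 → GammaRegular lam mu s →
      GammaRegular lam (fun j => starRingEnd ℂ (mu j)) (1 - s) →
      gammaFactor Q lam mu s * F s =
        ω * gammaFactor Q lam (fun j => starRingEnd ℂ (mu j)) (1 - s) *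
          starRingEnd ℂ (F (1 - starRingEnd ℂ s))

/-- Euler product: `log F(s) = ∑ b(n) n^{-s}` for `Re s > 1`, where `b(n) = 0` unless `n` is a
prime power `p^k` with `k ≥ 1`, and `b(n) ≪ n^θ` for some `θ < 1/2`. -/
def HasEulerProduct (F : ℂ → ℂ) : Prop :=
  ∃ b : ℕ → ℂ, (∀ n : ℕ, ¬ IsPrimePow n → b n = 0) ∧
    (∃ θ C : ℝ, θ < 1 / 2 ∧ ∀ n : ℕ, 1 ≤ n → ‖b n‖ ≤ C * (n : ℝ) ^ θ) ∧
    ∀ s : ℂ, 1 < s.re → ∃ L : ℂ, LSeriesHasSum b s L ∧ F s = Complex.exp L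

/-- The Selberg class. Its members are meromorphic functions on `ℂ` with at most a pole at `s = 1`,
represented by functions `ℂ → ℂ` whose value at `s = 1` is not constrained. -/
def SelbergClass : Set (ℂ → ℂ) :=
  {F | (∃ a : ℕ → ℂ, IsDirichletSeriesOf a F ∧ RamanujanCondition a) ∧
    HasContinuation F ∧ HasFunctionalEquation F ∧ HasEulerProduct F}

end Selberg

open MeasureTheory ProbabilityTheory Filter Topology

/-! The quotient `H = F / G` is bounded and holomorphic on `Re s > 1/2`, and for `Re s > 1` it
equals `exp (∑ c(n) n^{-s})`, where `c = b₁ - b₂` lives on prime powers. Two facts force `c = 0`.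

Boundedness makes `∑ c(n) n^{-1/2}` converge absolutely. Gaussian means along a vertical line
recover the coefficients `h(n) n^{-s}` of `H`, even for `1/2 < Re s ≤ 1`. Since `h` is
multiplicative, testing `H` against a Riesz product over primes, a nonnegative kernel of mean 1,
gives `|∏ (1 + e_p h(p^k) p^{-ks} / 2)| ≤ C`. With suitable phases `e_p` this yields `∑_p |h(p^k)|
p^{-k/2} ≤ 2C` for each `k` (`sum_norm_prime_pow_le`). A recursion passes from `h` to `c` for each
fixed `k`, and `θ < 1/2` handles all large `k` at once (`LSeriesSummable_half_of_bounded`).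

Hence `F = e^D G` on the critical line, with `D` an absolutely convergent Dirichlet series. The
functional equations fix the arguments of `F` and `G` modulo `π`, so `exp (2 i Im D)` is a quotient
of gamma factors. Gamma factors have multiplicative second differences tending to 1
(`tendsto_Gamma_sq_div`), so those of `exp (2 i Im D)` tend to 1 as well
(`tendsto_secondRatio_exp_sub_conj`). For a small step the logarithm is unambiguous, and the second
difference of `Im D` is an almost periodic function tending to 0 at infinity. All its Fourier
coefficients therefore vanish, and with them `c` (`coeff_eq_zero_of_tendsto_exp`). -/

/-! ### Exponentials for Dirichlet convolution -/

open LSeries in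
/-- Submultiplicativity of the sum of the absolute values of a Dirichlet series. -/
lemma tsum_norm_term_mul_le {f g : ArithmeticFunction ℂ} {s : ℂ}
    (hf : LSeriesSummable f s) (hg : LSeriesSummable g s) :
    ∑' n, ‖term (f * g : ArithmeticFunction ℂ) s n‖ ≤
      (∑' n, ‖term f s n‖) * ∑' n, ‖term g s n‖ := by
  -- Replacing coefficients by their moduli and `s` by `Re s` turns the right-hand side into the sum
  -- of a genuine convolution, which dominates the left one termwise.
  let N : ArithmeticFunction ℂ → ArithmeticFunction ℂ := fun u => ⟨fun n => (‖u n‖ : ℂ), by simp⟩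
  have hN : ∀ (u : ArithmeticFunction ℂ) (n : ℕ),
      term (N u) (s.re : ℂ) n = ((‖term u s n‖ : ℝ) : ℂ) := by
    intro u n
    rcases eq_or_ne n 0 with rfl | hn
    · simp
    · rw [term_of_ne_zero hn, norm_term_eq, if_neg hn]
      simp only [N, ArithmeticFunction.coe_mk]
      push_cast [Complex.ofReal_cpow (Nat.cast_nonneg n)]
      rfl
  have hS : ∀ u : ArithmeticFunction ℂ, LSeriesSummable u s →
      LSeriesHasSum (N u) (s.re : ℂ) ((∑' n, ‖term u s n‖ : ℝ) : ℂ) := by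
    intro u hu
    unfold LSeriesHasSum
    rw [show term (N u) (s.re : ℂ) = fun n => ((‖term u s n‖ : ℝ) : ℂ) from funext (hN u)]
    exact Complex.hasSum_ofReal.mpr (Summable.hasSum (Summable.norm hu))
  have h1 := ArithmeticFunction.LSeriesHasSum_mul (hS f hf) (hS g hg)
  have hterm : ∀ n, term (N f * N g : ArithmeticFunction ℂ) (s.re : ℂ) n =
      ((∑ p ∈ n.divisorsAntidiagonal, ‖term f s p.1‖ * ‖term g s p.2‖ : ℝ) : ℂ) := by
    intro n
    rw [← ArithmeticFunction.coe_mul, term_convolution]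
    push_cast
    exact Finset.sum_congr rfl fun p _ => by rw [hN, hN]
  unfold LSeriesHasSum at h1
  rw [funext hterm, ← Complex.ofReal_mul, Complex.hasSum_ofReal] at h1
  rw [← h1.tsum_eq]
  refine Summable.tsum_le_tsum (fun n => ?_)
    (Summable.norm (ArithmeticFunction.LSeriesSummable_mul hf hg)) h1.summable
  rw [← ArithmeticFunction.coe_mul, term_convolution]
  exact (norm_sum_le _ _).trans (Finset.sum_le_sum fun p _ => (norm_mul _ _).le)

lemma LSeriesHasSum_one_arith (s : ℂ) :
    LSeriesHasSum (1 : ArithmeticFunction ℂ) s 1 := by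
  have := hasSum_single (f := LSeries.term (1 : ArithmeticFunction ℂ) s) 1 (fun n hn => by
    simp [LSeries.term_def, ArithmeticFunction.one_apply_ne hn])
  simpa [LSeriesHasSum, LSeries.term_def] using this

lemma LSeriesHasSum_pow {c : ArithmeticFunction ℂ} {s : ℂ} (hc : LSeriesSummable c s) (m : ℕ) :
    LSeriesHasSum (c ^ m : ArithmeticFunction ℂ) s (LSeries c s ^ m) := by
  induction m with
  | zero => simpa using LSeriesHasSum_one_arith s
  | succ m ih =>
    rw [pow_succ, pow_succ]
    exact ArithmeticFunction.LSeriesHasSum_mul ih hc.LSeriesHasSum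

lemma tsum_norm_term_pow_le {c : ArithmeticFunction ℂ} {s : ℂ} (hc : LSeriesSummable c s) (m : ℕ) :
    ∑' n, ‖LSeries.term (c ^ m : ArithmeticFunction ℂ) s n‖ ≤
      (∑' n, ‖LSeries.term c s n‖) ^ m := by
  induction m with
  | zero =>
    have : ∀ n, ‖LSeries.term (1 : ArithmeticFunction ℂ) s n‖ = if n = 1 then 1 else 0 := by
      intro n
      by_cases hn : n = 1
      · subst hn; simp
      · simp [LSeries.term_def, ArithmeticFunction.one_apply_ne hn, hn]
    simp [this]
  | succ m ih =>
    rw [pow_succ, pow_succ]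
    refine (tsum_norm_term_mul_le (LSeriesHasSum_pow hc m).LSeriesSummable hc).trans ?_
    gcongr

/-- The exponential of an arithmetic function with respect to Dirichlet convolution. -/
noncomputable def dirichletExp (c : ArithmeticFunction ℂ) (n : ℕ) : ℂ :=
  ∑' m : ℕ, ((m.factorial : ℂ))⁻¹ * (c ^ m : ArithmeticFunction ℂ) n

/-- The row sums of norms are dominated by `x ^ m / m!` with `x = ∑ ‖term c s n‖`. Joint summability
is what allows the sums over `m` and `n` to be exchanged. -/
lemma summable_exp_terms {c : ArithmeticFunction ℂ} {s : ℂ} (hc : LSeriesSummable c s) :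
    Summable fun p : ℕ × ℕ => ((p.1.factorial : ℂ))⁻¹ *
      LSeries.term (c ^ p.1 : ArithmeticFunction ℂ) s p.2 := by
  apply Summable.of_norm
  rw [summable_prod_of_nonneg fun p => norm_nonneg _]
  refine ⟨fun m => ?_, ?_⟩
  · simp only [norm_mul]
    exact (Summable.norm (LSeriesHasSum_pow hc m).LSeriesSummable).mul_left _
  · refine Summable.of_nonneg_of_le (fun m => tsum_nonneg fun n => norm_nonneg _) (fun m => ?_)
      (Real.summable_pow_div_factorial (∑' n, ‖LSeries.term c s n‖))
    simp only [norm_mul]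
    rw [tsum_mul_left, div_eq_inv_mul, norm_inv, Complex.norm_natCast]
    gcongr
    exact tsum_norm_term_pow_le hc m

lemma summable_dirichletExp {c : ArithmeticFunction ℂ} {s : ℂ} (hc : LSeriesSummable c s) (n : ℕ) :
    Summable fun m : ℕ => ((m.factorial : ℂ))⁻¹ * (c ^ m : ArithmeticFunction ℂ) n := by
  rcases eq_or_ne n 0 with rfl | hn
  · simp
  have h := ((Equiv.prodComm ℕ ℕ).summable_iff.mpr (summable_exp_terms hc)).prod_factor n
  have h2 := h.mul_right ((n : ℂ) ^ s)
  refine h2.congr fun m => ?_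
  have : (n : ℂ) ^ s ≠ 0 := by simp [Complex.cpow_eq_zero_iff, hn]
  simp [LSeries.term_of_ne_zero hn, mul_assoc, this]

/-- The Dirichlet series of `dirichletExp c` is the exponential of the Dirichlet series of `c`. -/
lemma LSeriesHasSum_dirichletExp {c : ArithmeticFunction ℂ} {s : ℂ} (hc : LSeriesSummable c s) :
    LSeriesHasSum (dirichletExp c) s (Complex.exp (LSeries c s)) := by
  have hS := summable_exp_terms hc
  have h1 : HasSum (fun p : ℕ × ℕ => ((p.1.factorial : ℂ))⁻¹ *
      LSeries.term (c ^ p.1 : ArithmeticFunction ℂ) s p.2) (Complex.exp (LSeries c s)) := by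
    have h2 := hS.hasSum.prod_fiberwise
      (fun m => ((LSeriesHasSum_pow hc m : HasSum _ _).mul_left ((m.factorial : ℂ))⁻¹))
    have h3 : HasSum (fun m : ℕ => ((m.factorial : ℂ))⁻¹ * LSeries c s ^ m)
        (Complex.exp (LSeries c s)) := by
      have := NormedSpace.expSeries_div_hasSum_exp (LSeries c s)
      rw [← Complex.exp_eq_exp_ℂ] at this
      simpa [div_eq_inv_mul] using this
    rw [← h2.unique h3]
    exact hS.hasSum
  have h4 := (Equiv.prodComm ℕ ℕ).hasSum_iff.mpr h1
  refine h4.prod_fiberwise fun n => ?_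
  rcases eq_or_ne n 0 with rfl | hn
  · simp
  have h5 := (summable_dirichletExp hc n).hasSum.div_const ((n : ℂ) ^ s)
  rw [LSeries.term_of_ne_zero hn]
  refine h5.congr_fun ?_ |> fun h => h
  intro m
  simp [LSeries.term_of_ne_zero hn, mul_div_assoc]

lemma dirichletExp_one {c : ArithmeticFunction ℂ} (hc : c 1 = 0) : dirichletExp c 1 = 1 := by
  have : ∀ m, (c ^ m : ArithmeticFunction ℂ) 1 = if m = 0 then 1 else 0 := by
    intro m
    cases m with
    | zero => simp
    | succ m => simp [pow_succ, hc]
  simp [dirichletExp, this]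

/-! ### The logarithmic derivation, multiplicativity and the recursion at prime powers -/

/-- Multiplication by the logarithm, a derivation for Dirichlet convolution. -/
noncomputable def logDerivation (f : ArithmeticFunction ℂ) : ArithmeticFunction ℂ :=
  ⟨fun n => f n * (Real.log n : ℂ), by simp⟩

lemma logDerivation_apply (f : ArithmeticFunction ℂ) (n : ℕ) :
    logDerivation f n = f n * (Real.log n : ℂ) := rfl

lemma logDerivation_mul (f g : ArithmeticFunction ℂ) :
    logDerivation (f * g) = logDerivation f * g + f * logDerivation g := by
  ext n
  simp only [logDerivation_apply, ArithmeticFunction.mul_apply,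
    ArithmeticFunction.add_apply, Finset.sum_mul, ← Finset.sum_add_distrib]
  refine Finset.sum_congr rfl fun p hp => ?_
  have h0 := Nat.ne_zero_of_mem_divisorsAntidiagonal hp
  rw [← (Nat.mem_divisorsAntidiagonal.mp hp).1, Nat.cast_mul,
    Real.log_mul (by exact_mod_cast h0.1) (by exact_mod_cast h0.2)]
  push_cast
  ring

lemma logDerivation_pow (c : ArithmeticFunction ℂ) (m : ℕ) :
    logDerivation (c ^ (m + 1)) =
      ((m + 1 : ℕ) : ArithmeticFunction ℂ) * (logDerivation c * c ^ m) := by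
  induction m with
  | zero => simp
  | succ m ih =>
    rw [pow_succ, logDerivation_mul, ih]
    push_cast
    ring

lemma natCast_mul_apply (k : ℕ) (f : ArithmeticFunction ℂ) (n : ℕ) :
    ((k : ArithmeticFunction ℂ) * f) n = k * f n := by
  induction k with
  | zero => simp
  | succ k ih => simp [add_mul, ih]

/-- The differential equation of the exponential, `(exp c)' = c' * exp c`, for the derivation
`logDerivation`. It holds term by term in the exponential series. -/
lemma dirichletExp_mul_log {c : ArithmeticFunction ℂ} {s : ℂ} (hc : LSeriesSummable c s) (n : ℕ) :
    dirichletExp c n * (Real.log n : ℂ) =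
      ∑ p ∈ n.divisorsAntidiagonal, c p.1 * (Real.log p.1 : ℂ) * dirichletExp c p.2 := by
  have h1 := (summable_dirichletExp hc n).hasSum.mul_right (Real.log n : ℂ)
  have h2 : HasSum (fun m : ℕ => ∑ p ∈ n.divisorsAntidiagonal,
      c p.1 * (Real.log p.1 : ℂ) * (((m.factorial : ℂ))⁻¹ * (c ^ m : ArithmeticFunction ℂ) p.2))
      (∑ p ∈ n.divisorsAntidiagonal, c p.1 * (Real.log p.1 : ℂ) * dirichletExp c p.2) :=
    hasSum_sum fun p _ => (summable_dirichletExp hc p.2).hasSum.mul_left _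
  have h3 : ∀ m : ℕ, (((m + 1).factorial : ℂ))⁻¹ * (c ^ (m + 1) : ArithmeticFunction ℂ) n *
      (Real.log n : ℂ) = ∑ p ∈ n.divisorsAntidiagonal,
      c p.1 * (Real.log p.1 : ℂ) * (((m.factorial : ℂ))⁻¹ * (c ^ m : ArithmeticFunction ℂ) p.2) := by
    intro m
    have := congrArg (fun f : ArithmeticFunction ℂ => f n) (logDerivation_pow c m)
    simp only [natCast_mul_apply] at this
    simp only [logDerivation_apply, ArithmeticFunction.mul_apply] at this
    rw [mul_assoc, this, Nat.factorial_succ, Finset.mul_sum, Finset.mul_sum]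
    refine Finset.sum_congr rfl fun p _ => ?_
    have : ((m : ℂ) + 1) ≠ 0 := by exact_mod_cast Nat.succ_ne_zero m
    have := Nat.cast_ne_zero (R := ℂ).mpr (Nat.factorial_ne_zero m)
    push_cast
    field_simp
  -- The term `m = 0` drops out because the convolution unit lives at `n = 1`, where `log` vanishes;
  -- the remaining series is shifted by one.
  have h4 : (((0 : ℕ).factorial : ℂ))⁻¹ * (c ^ 0 : ArithmeticFunction ℂ) n * (Real.log n : ℂ) = 0 := by
    rcases eq_or_ne n 1 with rfl | hn
    · simp
    · simp [ArithmeticFunction.one_apply_ne hn]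
  rw [← hasSum_nat_add_iff' 1] at h1
  simp only [Finset.range_one, Finset.sum_singleton, h4, sub_zero, h3] at h1
  exact h1.unique h2

lemma dirichletExp_mul_log' {c : ArithmeticFunction ℂ} {s : ℂ} (hc : LSeriesSummable c s) (n : ℕ) :
    dirichletExp c n * (Real.log n : ℂ) =
      ∑ d ∈ n.divisors, c d * (Real.log d : ℂ) * dirichletExp c (n / d) := by
  rw [dirichletExp_mul_log hc, Nat.sum_divisorsAntidiagonal
    (f := fun a b => c a * (Real.log a : ℂ) * dirichletExp c b)]

/-- A prime power dividing a product of coprime numbers divides exactly one of them. -/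
lemma sum_divisors_mul_of_isPrimePow {φ : ℕ → ℂ} (hφ : ∀ n, ¬ IsPrimePow n → φ n = 0) {m n : ℕ}
    (hmn : m.Coprime n) :
    ∑ d ∈ (m * n).divisors, φ d = ∑ d ∈ m.divisors, φ d + ∑ d ∈ n.divisors, φ d := by
  have hf : ∀ S : Finset ℕ, ∑ d ∈ S, φ d = ∑ d ∈ S.filter IsPrimePow, φ d := fun S =>
    (Finset.sum_filter_of_ne fun d _ hd => by_contra fun h => hd (hφ d h)).symm
  rw [hf, hf m.divisors, hf n.divisors, Nat.mul_divisors_filter_prime_pow hmn,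
    Finset.filter_union, Finset.sum_union]
  rw [Finset.disjoint_left]
  intro d hd hd'
  simp only [Finset.mem_filter, Nat.mem_divisors] at hd hd'
  have := Nat.eq_one_of_dvd_coprimes hmn hd.1.1 hd'.1.1
  exact hd.2.ne_one this

/-- Strong induction on `m * n`: the recursion for `exp c` splits into divisors of `m` and divisors
of `n`, which reassemble to `log m + log n` times the product. -/
lemma dirichletExp_mul_of_coprime {c : ArithmeticFunction ℂ} {s : ℂ} (hc : LSeriesSummable c s)
    (hsupp : ∀ n, ¬ IsPrimePow n → c n = 0) {m n : ℕ} (hm : m ≠ 0) (hn : n ≠ 0)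
    (hmn : m.Coprime n) :
    dirichletExp c (m * n) = dirichletExp c m * dirichletExp c n := by
  have hc1 : c 1 = 0 := hsupp 1 not_isPrimePow_one
  induction hN : m * n using Nat.strong_induction_on generalizing m n with
  | _ N ih =>
  subst hN
  have hpos : 0 < m * n := Nat.pos_of_ne_zero (mul_ne_zero hm hn)
  rcases eq_or_ne (m * n) 1 with h1 | h1
  · obtain ⟨rfl, rfl⟩ := mul_eq_one.mp h1
    simp [dirichletExp_one hc1]
  have hlog : (Real.log ((m * n : ℕ) : ℝ) : ℂ) ≠ 0 := by
    have : (1 : ℝ) < ((m * n : ℕ) : ℝ) := by exact_mod_cast (by omega : 1 < m * n)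
    exact_mod_cast (Real.log_pos this).ne'
  apply mul_right_cancel₀ hlog
  rw [dirichletExp_mul_log' hc]
  rw [sum_divisors_mul_of_isPrimePow (fun d hd => by simp [hsupp d hd]) hmn]
  have e1 : ∑ d ∈ m.divisors, c d * (Real.log d : ℂ) * dirichletExp c (m * n / d) =
      dirichletExp c m * (Real.log m : ℂ) * dirichletExp c n := by
    rw [dirichletExp_mul_log' hc m, Finset.sum_mul]
    refine Finset.sum_congr rfl fun d hd => ?_
    by_cases hcd : c d = 0
    · simp [hcd]
    -- Since `c 1 = 0`, only `d ≥ 2` contributes, so the cofactor is strictly smaller and the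
    -- induction hypothesis applies.
    have hd1 : d ≠ 1 := fun h => hcd (h ▸ hc1)
    obtain ⟨e, rfl⟩ := (Nat.mem_divisors.mp hd).1
    have hd0 : d ≠ 0 := fun h => hm (by simp [h])
    have he0 : e ≠ 0 := fun h => hm (by simp [h])
    have hd0' := Nat.pos_of_ne_zero hd0
    rw [mul_assoc d e n, Nat.mul_div_cancel_left _ hd0', Nat.mul_div_cancel_left _ hd0']
    rw [ih (e * n) ?_ he0 hn hmn.coprime_mul_left rfl]
    · ring
    · rw [mul_assoc]
      have : 0 < e * n := Nat.pos_of_ne_zero (mul_ne_zero he0 hn)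
      nlinarith [show 2 ≤ d by omega]
  have e2 : ∑ d ∈ n.divisors, c d * (Real.log d : ℂ) * dirichletExp c (m * n / d) =
      dirichletExp c m * (dirichletExp c n * (Real.log n : ℂ)) := by
    rw [dirichletExp_mul_log' hc n, Finset.mul_sum]
    refine Finset.sum_congr rfl fun d hd => ?_
    by_cases hcd : c d = 0
    · simp [hcd]
    have hd1 : d ≠ 1 := fun h => hcd (h ▸ hc1)
    obtain ⟨e, rfl⟩ := (Nat.mem_divisors.mp hd).1
    have hd0 : d ≠ 0 := fun h => hn (by simp [h])
    have he0 : e ≠ 0 := fun h => hn (by simp [h])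
    have hd0' := Nat.pos_of_ne_zero hd0
    rw [mul_left_comm m d e, Nat.mul_div_cancel_left _ hd0', Nat.mul_div_cancel_left _ hd0']
    rw [ih (m * e) ?_ hm he0 hmn.coprime_mul_left_right rfl]
    · ring
    · have : 0 < m * e := Nat.pos_of_ne_zero (mul_ne_zero hm he0)
      nlinarith [show 2 ≤ d by omega]
  rw [e1, e2, Nat.cast_mul, Real.log_mul (by exact_mod_cast hm) (by exact_mod_cast hn)]
  push_cast
  ring

lemma dirichletExp_prod_prime_pow {c : ArithmeticFunction ℂ} {s : ℂ} (hc : LSeriesSummable c s)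
    (hsupp : ∀ n, ¬ IsPrimePow n → c n = 0) (k : ℕ) (A : Finset ℕ) (hA : ∀ p ∈ A, p.Prime) :
    dirichletExp c (∏ p ∈ A, p ^ k) = ∏ p ∈ A, dirichletExp c (p ^ k) := by
  induction A using Finset.induction_on with
  | empty => simp [dirichletExp_one (hsupp 1 not_isPrimePow_one)]
  | insert p A hp ih =>
    rw [Finset.prod_insert hp, Finset.prod_insert hp, dirichletExp_mul_of_coprime hc hsupp,
      ih fun q hq => hA q (Finset.mem_insert_of_mem hq)]
    · exact pow_ne_zero _ (hA p (Finset.mem_insert_self _ _)).ne_zero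
    · exact Finset.prod_ne_zero_iff.mpr fun q hq =>
        pow_ne_zero _ (hA q (Finset.mem_insert_of_mem hq)).ne_zero
    · refine Nat.Coprime.prod_right fun q hq => Nat.Coprime.pow _ _ ?_
      exact (Nat.coprime_primes (hA p (Finset.mem_insert_self _ _))
        (hA q (Finset.mem_insert_of_mem hq))).mpr fun h => hp (h ▸ hq)

lemma dirichletExp_prime_pow {c : ArithmeticFunction ℂ} {s : ℂ} (hc : LSeriesSummable c s)
    {p : ℕ} (hp : p.Prime) (k : ℕ) :
    k * dirichletExp c (p ^ k) =
      ∑ j ∈ Finset.range (k + 1), j * c (p ^ j) * dirichletExp c (p ^ (k - j)) := by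
  have hlog : (Real.log (p : ℝ) : ℂ) ≠ 0 := by
    exact_mod_cast (Real.log_pos (by exact_mod_cast hp.one_lt)).ne'
  apply mul_right_cancel₀ hlog
  have h := dirichletExp_mul_log' hc (p ^ k)
  rw [Nat.sum_divisors_prime_pow hp] at h
  rw [Nat.cast_pow, Real.log_pow, Complex.ofReal_mul, Complex.ofReal_natCast] at h
  rw [mul_comm (k : ℂ), mul_assoc, h, Finset.sum_mul]
  refine Finset.sum_congr rfl fun j hj => ?_
  have hj' : j ≤ k := by simpa [Nat.lt_succ_iff] using hj
  rw [Nat.pow_div hj' hp.pos, Nat.cast_pow, Real.log_pow, Complex.ofReal_mul, Complex.ofReal_natCast]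
  ring

/-! ### Gaussian means and Bohr–Fourier coefficients -/

/-- The mean of `f` with respect to a centred Gaussian of standard deviation `T`. -/
noncomputable def gaussMean (f : ℝ → ℂ) (T : ℝ) : ℂ := ∫ v, f (T * v) ∂(gaussianReal 0 1)

lemma integrable_gaussian_of_continuous_of_bounded {f : ℝ → ℂ} (hf : Continuous f) {C : ℝ}
    (hC : ∀ u, ‖f u‖ ≤ C) (T : ℝ) : Integrable (fun v => f (T * v)) (gaussianReal 0 1) :=
  Integrable.of_bound (C := C) (by fun_prop) (Eventually.of_forall fun v => hC _)

lemma gaussMean_exp (l T : ℝ) :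
    gaussMean (fun u => Complex.exp ((l * u : ℝ) * Complex.I)) T =
      (Real.exp (-(T * l) ^ 2 / 2) : ℂ) := by
  have h := charFun_apply_real (μ := gaussianReal 0 1) (T * l)
  rw [charFun_gaussianReal] at h
  unfold gaussMean
  rw [Complex.ofReal_exp]
  convert h.symm using 2
  · ext v
    push_cast
    ring_nf
  · push_cast
    simp
    ring

/-- The Gaussian weight attached to `n` in the Gaussian mean with frequency `l`. -/
noncomputable def gaussWeight (l T : ℝ) (n : ℕ) : ℝ := Real.exp (-(T * (l - Real.log n)) ^ 2 / 2)

/-- Completing the square in `l - log n`: a Gaussian in `log n` beats every power of `n`, uniformly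
in `T ≥ 1`. With `A = 2 - Re s` this reduces any `s` to the point 2 of absolute convergence. -/
lemma gaussWeight_le {l T : ℝ} (hT : 1 ≤ T) (A : ℝ) {n : ℕ} (hn : n ≠ 0) :
    gaussWeight l T n * (n : ℝ) ^ A ≤ Real.exp (A * l + A ^ 2 / 2) := by
  have hn' : (0 : ℝ) < n := by exact_mod_cast Nat.pos_of_ne_zero hn
  unfold gaussWeight
  rw [Real.rpow_def_of_pos hn', ← Real.exp_add]
  apply Real.exp_le_exp.mpr
  have h1 : (l - Real.log n) ^ 2 ≤ (T * (l - Real.log n)) ^ 2 := by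
    rw [mul_pow]
    have : 1 ≤ T ^ 2 := one_le_pow₀ hT
    nlinarith [sq_nonneg (l - Real.log n)]
  nlinarith [sq_nonneg (l - Real.log n + A)]

lemma norm_term_gaussWeight_le {h : ℕ → ℂ} {l T : ℝ} (hT : 1 ≤ T) (s : ℂ) (n : ℕ) :
    ‖LSeries.term (fun n => h n * (gaussWeight l T n : ℂ)) s n‖ ≤
      Real.exp ((2 - s.re) * l + (2 - s.re) ^ 2 / 2) * ‖LSeries.term h 2 n‖ := by
  rcases eq_or_ne n 0 with rfl | hn
  · simp
  have hn' : (0 : ℝ) < n := by exact_mod_cast Nat.pos_of_ne_zero hn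
  rw [LSeries.norm_term_eq, LSeries.norm_term_eq, if_neg hn, if_neg hn, norm_mul]
  have h1 := gaussWeight_le (l := l) hT (2 - s.re) hn
  rw [Real.rpow_sub hn'] at h1
  have hw : ‖(gaussWeight l T n : ℂ)‖ = gaussWeight l T n := by
    rw [Complex.norm_real]; exact abs_of_pos (Real.exp_pos _)
  rw [hw]
  have hp1 := Real.rpow_pos_of_pos hn' s.re
  have hp2 := Real.rpow_pos_of_pos hn' 2
  simp only [Complex.re_ofNat]
  calc ‖h n‖ * gaussWeight l T n / (n : ℝ) ^ s.re
      = gaussWeight l T n * ((n : ℝ) ^ (2 : ℝ) / (n : ℝ) ^ s.re) * (‖h n‖ / (n : ℝ) ^ (2 : ℝ)) := by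
        field_simp
    _ ≤ _ := by gcongr

lemma LSeriesSummable_gaussWeight {h : ℕ → ℂ} (hh : LSeriesSummable h 2) {l T : ℝ} (hT : 1 ≤ T)
    (s : ℂ) : LSeriesSummable (fun n => h n * (gaussWeight l T n : ℂ)) s :=
  Summable.of_norm_bounded ((Summable.norm hh).mul_left _) (norm_term_gaussWeight_le hT s)

lemma tendsto_LSeries_gaussWeight {h : ℕ → ℂ} (hh : LSeriesSummable h 2) (l : ℝ) (s : ℂ) :
    Tendsto (fun T : ℝ => LSeries (fun n => h n * (gaussWeight l T n : ℂ)) s) atTop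
      (𝓝 (∑' n, LSeries.term h s n * if l = Real.log n then 1 else 0)) := by
  refine tendsto_tsum_of_dominated_convergence ((Summable.norm hh).mul_left _) (fun n => ?_)
    ((eventually_ge_atTop 1).mono fun T hT n => norm_term_gaussWeight_le hT s n)
  have h1 : ∀ T, LSeries.term (fun n => h n * (gaussWeight l T n : ℂ)) s n =
      LSeries.term h s n * (gaussWeight l T n : ℂ) := by
    intro T
    simp only [LSeries.term_def]
    split_ifs
    · simp
    · ring
  simp only [h1]
  refine Tendsto.const_mul _ ?_
  split_ifs with hl
  · simp [gaussWeight, hl]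
  · have hl' : 0 < (l - Real.log n) ^ 2 := by
      have := sub_ne_zero.mpr hl
      positivity
    have h2 : Tendsto (fun T : ℝ => gaussWeight l T n) atTop (𝓝 0) := by
      refine Real.tendsto_exp_atBot.comp ?_
      have h3 : Tendsto (fun T : ℝ => T ^ 2 * ((l - Real.log n) ^ 2 / 2)) atTop atTop :=
        (tendsto_pow_atTop two_ne_zero).atTop_mul_const (by positivity)
      refine (tendsto_neg_atTop_atBot.comp h3).congr fun T => ?_
      simp only [Function.comp_apply]
      ring
    exact (Complex.continuous_ofReal.tendsto' 0 0 rfl).comp h2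

lemma continuous_vertical {H : ℂ → ℂ} {a : ℝ} (hH : DifferentiableOn ℂ H {s | a < s.re}) {s : ℂ}
    (hs : a < s.re) : Continuous fun u : ℝ => H (s + u * Complex.I) := by
  refine hH.continuousOn.comp_continuous (by fun_prop) fun u => ?_
  simpa using hs

lemma isOpen_re_gt (a : ℝ) : IsOpen {s : ℂ | a < s.re} :=
  isOpen_lt continuous_const Complex.continuous_re

lemma norm_exp_ofReal_mul_ofReal_mul_I (l u : ℝ) :
    ‖Complex.exp ((l * u : ℝ) * Complex.I)‖ = 1 := Complex.norm_exp_ofReal_mul_I _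

/-- Twisted Gaussian means of a bounded holomorphic function along vertical lines depend
holomorphically on the line. -/
lemma differentiableOn_gaussMean {H : ℂ → ℂ} {a C : ℝ} (hH : DifferentiableOn ℂ H {s | a < s.re})
    (hC : ∀ s : ℂ, a < s.re → ‖H s‖ ≤ C) (l T : ℝ) :
    DifferentiableOn ℂ (fun s => gaussMean (fun u => H (s + u * Complex.I) *
      Complex.exp ((l * u : ℝ) * Complex.I)) T) {s | a < s.re} := by
  intro s₀ hs₀
  simp only [Set.mem_ofPred_eq] at hs₀
  have hU := isOpen_re_gt a
  have hH' : DifferentiableOn ℂ (deriv H) {s | a < s.re} := hH.deriv hU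
  -- A quarter of the distance to the boundary leaves room for a disc of radius `r` around each
  -- translate of a point of the `r`-ball, so Cauchy's estimate bounds the derivative by `C / r`
  -- everywhere.
  set r : ℝ := (s₀.re - a) / 4 with hr
  have hr0 : 0 < r := by rw [hr]; linarith
  have hball : ∀ s ∈ Metric.ball s₀ r, ∀ v : ℝ, ∀ z ∈ Metric.closedBall (s + (v : ℂ) * Complex.I) r,
      a < z.re := by
    intro s hs v z hz
    rw [Metric.mem_ball, dist_eq_norm] at hs
    rw [Metric.mem_closedBall, dist_eq_norm] at hz
    have h1 := (Complex.abs_re_le_norm _).trans hz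
    have h2 := (Complex.abs_re_le_norm _).trans hs.le
    simp only [Complex.sub_re, Complex.add_re, Complex.mul_re, Complex.ofReal_re, Complex.I_re,
      mul_zero, Complex.ofReal_im, Complex.I_im, mul_one, sub_zero, add_zero] at h1 h2
    rw [abs_le] at h1 h2
    rw [hr] at *
    linarith
  have hmem : ∀ s ∈ Metric.ball s₀ r, ∀ v : ℝ, a < (s + (v : ℂ) * Complex.I).re :=
    fun s hs v => hball s hs v _ (Metric.mem_closedBall_self hr0.le)
  have key := hasDerivAt_integral_of_dominated_loc_of_deriv_le (μ := gaussianReal 0 1)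
    (F := fun s (v : ℝ) => H (s + ((T * v : ℝ) : ℂ) * Complex.I) *
      Complex.exp ((l * (T * v) : ℝ) * Complex.I))
    (F' := fun s (v : ℝ) => deriv H (s + ((T * v : ℝ) : ℂ) * Complex.I) *
      Complex.exp ((l * (T * v) : ℝ) * Complex.I))
    (bound := fun _ => C / r)
    (Metric.ball_mem_nhds s₀ hr0) ?_ ?_ ?_ ?_ (integrable_const _) ?_
  · exact key.2.differentiableAt.differentiableWithinAt
  · filter_upwards [Metric.ball_mem_nhds s₀ hr0] with s hs
    have := continuous_vertical hH (s := s) (by simpa using hmem s hs 0)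
    exact ((this.comp (continuous_const_mul T)).mul
      (by fun_prop)).aestronglyMeasurable
  · have h1 := continuous_vertical hH hs₀
    refine integrable_gaussian_of_continuous_of_bounded (C := C)
      (f := fun u => H (s₀ + (u : ℂ) * Complex.I) * Complex.exp ((l * u : ℝ) * Complex.I))
      (h1.mul (by fun_prop)) (fun u => ?_) T
    rw [norm_mul, norm_exp_ofReal_mul_ofReal_mul_I, mul_one]
    exact hC _ (by simpa using hs₀)
  · have := continuous_vertical hH' hs₀
    exact ((this.comp (continuous_const_mul T)).mul
      (by fun_prop)).aestronglyMeasurable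
  · refine Eventually.of_forall fun v s hs => ?_
    rw [norm_mul, norm_exp_ofReal_mul_ofReal_mul_I, mul_one]
    refine Complex.norm_deriv_le_of_forall_mem_sphere_norm_le hr0 ?_ fun z hz =>
      hC z (hball s hs _ z (Metric.sphere_subset_closedBall hz))
    exact (hH.mono fun z hz => hball s hs _ z hz).diffContOnCl_ball subset_rfl
  · refine Eventually.of_forall fun v s hs => ?_
    refine HasDerivAt.mul_const ?_ _
    have h1 := (hH.differentiableAt (hU.mem_nhds (hmem s hs (T * v)))).hasDerivAt
    exact h1.comp_add_const s _

lemma gaussMean_eq_LSeries_of_one_lt {H : ℂ → ℂ} {h : ℕ → ℂ}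
    (hh : ∀ s : ℂ, 1 < s.re → LSeriesHasSum h s (H s)) (l T : ℝ) {s : ℂ} (hs : 1 < s.re) :
    gaussMean (fun u => H (s + u * Complex.I) * Complex.exp ((l * u : ℝ) * Complex.I)) T =
      LSeries (fun n => h n * (gaussWeight l T n : ℂ)) s := by
  have hre : ∀ u : ℝ, 1 < (s + u * Complex.I).re := fun u => by simpa using hs
  have hterm : ∀ (n : ℕ) (u : ℝ), LSeries.term h (s + u * Complex.I) n *
      Complex.exp ((l * u : ℝ) * Complex.I) =
      LSeries.term h s n * Complex.exp (((l - Real.log n) * u : ℝ) * Complex.I) := by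
    intro n u
    rcases eq_or_ne n 0 with rfl | hn
    · simp
    have hn' : (n : ℂ) ≠ 0 := by exact_mod_cast hn
    rw [LSeries.term_of_ne_zero hn, LSeries.term_of_ne_zero hn, Complex.cpow_add _ _ hn']
    rw [Complex.cpow_def_of_ne_zero hn' (u * Complex.I), Complex.natCast_log.symm]
    rw [show (((l - Real.log n) * u : ℝ) : ℂ) * Complex.I =
      (l * u : ℝ) * Complex.I - Real.log n * (u * Complex.I) by push_cast; ring, Complex.exp_sub]
    have : (n : ℂ) ^ s ≠ 0 := by simp [Complex.cpow_eq_zero_iff, hn]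
    have := Complex.exp_ne_zero (Real.log n * (u * Complex.I))
    field_simp
  have hnorm : ∀ (n : ℕ) (u : ℝ), ‖LSeries.term h s n *
      Complex.exp (((l - Real.log n) * u : ℝ) * Complex.I)‖ = ‖LSeries.term h s n‖ := by
    intro n u
    rw [norm_mul, norm_exp_ofReal_mul_ofReal_mul_I, mul_one]
  have hcont : ∀ n : ℕ, Continuous fun u : ℝ => LSeries.term h s n *
      Complex.exp (((l - Real.log n) * u : ℝ) * Complex.I) := fun n => by fun_prop
  have key := hasSum_integral_of_summable_integral_norm (μ := gaussianReal 0 1)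
    (F := fun n (v : ℝ) => LSeries.term h s n *
      Complex.exp (((l - Real.log n) * (T * v) : ℝ) * Complex.I))
    (fun n => integrable_gaussian_of_continuous_of_bounded (hcont n) (fun u => (hnorm n u).le) T)
    (by
      simp only [hnorm]
      simpa using Summable.norm (hh s hs).LSeriesSummable)
  unfold gaussMean LSeries
  have e1 : ∀ v : ℝ, H (s + ((T * v : ℝ) : ℂ) * Complex.I) *
      Complex.exp ((l * (T * v) : ℝ) * Complex.I) = ∑' n, LSeries.term h s n *
      Complex.exp (((l - Real.log n) * (T * v) : ℝ) * Complex.I) := by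
    intro v
    rw [← (hh _ (hre (T * v))).LSeries_eq, LSeries, ← tsum_mul_right]
    exact tsum_congr fun n => hterm n _
  simp only [e1]
  rw [← key.tsum_eq]
  refine tsum_congr fun n => ?_
  rw [integral_const_mul]
  have := gaussMean_exp (l - Real.log n) T
  unfold gaussMean at this
  rw [this]
  simp only [LSeries.term_def, gaussWeight]
  split_ifs
  · simp
  · ring

/-- The Bohr–Fourier coefficients of a bounded holomorphic function on `Re s > 1/2` that is given
by an absolutely convergent Dirichlet series on `Re s > 1`. -/
lemma tendsto_gaussMean_mul_exp {H : ℂ → ℂ} {h : ℕ → ℂ} {C : ℝ}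
    (hH : DifferentiableOn ℂ H {s | 1 / 2 < s.re}) (hC : ∀ s : ℂ, 1 / 2 < s.re → ‖H s‖ ≤ C)
    (hh : ∀ s : ℂ, 1 < s.re → LSeriesHasSum h s (H s)) (l : ℝ) {s : ℂ} (hs : 1 / 2 < s.re) :
    Tendsto (gaussMean (fun u => H (s + u * Complex.I) *
      Complex.exp ((l * u : ℝ) * Complex.I))) atTop
      (𝓝 (∑' n, LSeries.term h s n * if l = Real.log n then 1 else 0)) := by
  have h2 : LSeriesSummable h 2 := (hh 2 (by norm_num)).LSeriesSummable
  refine (tendsto_LSeries_gaussWeight h2 l s).congr' ?_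
  filter_upwards [eventually_ge_atTop 1] with T hT
  have hU := isOpen_re_gt (1 / 2)
  -- For fixed `T` both the mean and the Gaussian-weighted series are analytic on `Re s > 1/2`. They
  -- agree for `Re s > 1`, hence throughout; only then does `T` tend to infinity.
  have a1 := (differentiableOn_gaussMean hH hC l T).analyticOnNhd hU
  have a2 : AnalyticOnNhd ℂ (LSeries (fun n => h n * (gaussWeight l T n : ℂ)))
      {s | 1 / 2 < s.re} := by
    refine (LSeries_analyticOnNhd _).mono fun z hz => ?_
    have := (LSeriesSummable_gaussWeight h2 (l := l) hT (1 / 2 : ℂ)).abscissaOfAbsConv_le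
    refine lt_of_le_of_lt this ?_
    rw [show ((1 / 2 : ℂ)).re = 1 / 2 by norm_num]
    exact_mod_cast hz
  have := a2.eqOn_of_preconnected_of_eventuallyEq a1 (convex_halfSpace_re_gt _).isPreconnected
    (z₀ := 2) (by norm_num) ?_
  · exact this hs
  · filter_upwards [(isOpen_re_gt 1).mem_nhds (show (2 : ℂ) ∈ {s : ℂ | 1 < s.re} by norm_num)] with z hz
    exact (gaussMean_eq_LSeries_of_one_lt hh l T hz).symm

lemma tsum_term_mul_ite_log {h : ℕ → ℂ} {s : ℂ} {l : ℝ} {n : ℕ} (hn : n ≠ 0) (hl : l = Real.log n) :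
    (∑' n, LSeries.term h s n * if l = Real.log n then 1 else 0) = LSeries.term h s n := by
  rw [tsum_eq_single n, if_pos hl, mul_one]
  intro m hm
  rcases eq_or_ne m 0 with rfl | hm0
  · simp
  rw [if_neg, mul_zero]
  intro h
  rw [hl] at h
  have := Real.log_injOn_pos (by simpa using Nat.pos_of_ne_zero hn)
    (by simpa using Nat.pos_of_ne_zero hm0) h
  exact hm (by exact_mod_cast this.symm)

lemma tsum_term_mul_ite_log_eq_zero {h : ℕ → ℂ} {s : ℂ} {l : ℝ}
    (hl : ∀ n : ℕ, n ≠ 0 → l ≠ Real.log n) :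
    (∑' n, LSeries.term h s n * if l = Real.log n then 1 else 0) = 0 := by
  refine (tsum_congr fun n => ?_).trans tsum_zero
  rcases eq_or_ne n 0 with rfl | hn
  · simp
  · rw [if_neg (hl n hn), mul_zero]

/-! ### Riesz products over primes -/

/-- The Fourier coefficients of the trigonometric polynomial `1 + Re (z e^{ix})`. -/
noncomputable def rieszCoeff (z : ℂ) (j : ℤ) : ℂ :=
  if j = 0 then 1 else if j = 1 then z / 2 else starRingEnd ℂ z / 2

/-- The Riesz product `∏ (1 + Re (e_p p^{iku}))` over the primes `p ∈ S`. -/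
noncomputable def rieszKernel (S : Finset ℕ) (k : ℕ) (e : ℕ → ℂ) (u : ℝ) : ℝ :=
  ∏ p ∈ S, (1 + (e p * Complex.exp ((k * Real.log p * u : ℝ) * Complex.I)).re)

lemma rieszKernel_nonneg {S : Finset ℕ} {k : ℕ} {e : ℕ → ℂ} (he : ∀ p, ‖e p‖ ≤ 1) (u : ℝ) :
    0 ≤ rieszKernel S k e u := by
  refine Finset.prod_nonneg fun p _ => ?_
  have h1 := Complex.abs_re_le_norm (e p * Complex.exp ((k * Real.log p * u : ℝ) * Complex.I))
  rw [norm_mul, norm_exp_ofReal_mul_ofReal_mul_I, mul_one] at h1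
  have := (abs_le.mp (h1.trans (he p))).1
  linarith

lemma continuous_rieszKernel (S : Finset ℕ) (k : ℕ) (e : ℕ → ℂ) :
    Continuous (rieszKernel S k e) := by
  unfold rieszKernel
  fun_prop

lemma rieszKernel_eq_sum (S : Finset ℕ) (k : ℕ) (e : ℕ → ℂ) (u : ℝ) :
    (rieszKernel S k e u : ℂ) =
      ∑ v ∈ Fintype.piFinset (fun _ : S => ({-1, 0, 1} : Finset ℤ)),
        (∏ p : S, rieszCoeff (e p) (v p)) *
          Complex.exp (((∑ p : S, v p * (k * Real.log p)) * u : ℝ) * Complex.I) := by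
  have h1 : (rieszKernel S k e u : ℂ) = ∏ p : S, ∑ j ∈ ({-1, 0, 1} : Finset ℤ),
      rieszCoeff (e p) j * Complex.exp ((j * (k * Real.log p) * u : ℝ) * Complex.I) := by
    unfold rieszKernel
    rw [Complex.ofReal_prod, ← Finset.prod_coe_sort S]
    refine Finset.prod_congr rfl fun p _ => ?_
    rw [Complex.ofReal_add, Complex.re_eq_add_conj, map_mul, ← Complex.exp_conj]
    generalize (k : ℝ) * Real.log (p : ℕ) = x
    simp [rieszCoeff]
    ring_nf
  rw [h1, Finset.prod_univ_sum]
  refine Finset.sum_congr rfl fun v _ => ?_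
  rw [Finset.prod_mul_distrib, ← Complex.exp_sum]
  congr 2
  rw [Finset.sum_mul, Complex.ofReal_sum, Finset.sum_mul]

lemma term_prod_prime_pow {h : ℕ → ℂ} {k : ℕ} {s : ℂ} (A : Finset ℕ) (hA : ∀ p ∈ A, p.Prime)
    (hmul : h (∏ p ∈ A, p ^ k) = ∏ p ∈ A, h (p ^ k)) :
    LSeries.term h s (∏ p ∈ A, p ^ k) = ∏ p ∈ A, LSeries.term h s (p ^ k) := by
  have h0 : ∀ p ∈ A, p ^ k ≠ 0 := fun p hp => pow_ne_zero _ (hA p hp).ne_zero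
  rw [LSeries.term_of_ne_zero (Finset.prod_ne_zero_iff.mpr h0), hmul, Nat.cast_prod]
  rw [Finset.prod_congr rfl fun p hp => LSeries.term_of_ne_zero (h0 p hp) h s,
    Finset.prod_div_distrib]
  congr 1
  clear hmul
  induction A using Finset.induction_on with
  | empty => simp
  | insert p A hp ih =>
    rw [Finset.prod_insert hp, Finset.prod_insert hp, ← ih
      (fun q hq => hA q (Finset.mem_insert_of_mem hq))
      (fun q hq => h0 q (Finset.mem_insert_of_mem hq)), ← Nat.cast_prod,
      Complex.natCast_mul_natCast_cpow]

/-- Unique factorisation: a frequency with some `v q = -1` is not of the form `log n`, since `q`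
would divide a product of powers of other primes. Otherwise it is `log n` for exactly one `n`, the
product of the `p ^ k` with `v p = 1`. -/
lemma tsum_term_mul_ite_riesz {h : ℕ → ℂ} {k : ℕ} (hk : k ≠ 0) {S : Finset ℕ}
    (hS : ∀ p ∈ S, p.Prime) (hmul : ∀ A ⊆ S, h (∏ p ∈ A, p ^ k) = ∏ p ∈ A, h (p ^ k)) (s : ℂ)
    (v : S → ℤ) (hv : ∀ p, v p = -1 ∨ v p = 0 ∨ v p = 1) :
    (∑' n, LSeries.term h s n *
      if (∑ p : S, v p * (k * Real.log p) : ℝ) = Real.log n then 1 else 0) =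
    ∏ p : S, if v p = 0 then 1 else if v p = 1 then LSeries.term h s (p ^ k) else 0 := by
  have hpos : ∀ p : S, (0 : ℝ) < (p : ℕ) := fun p => by exact_mod_cast (hS p p.2).pos
  have hlog : ∀ B : Finset S, Real.log ((∏ p ∈ B, (p : ℕ) ^ k : ℕ) : ℝ) =
      ∑ p ∈ B, (k * Real.log p) := by
    intro B
    push_cast
    rw [Real.log_prod fun p _ => (pow_pos (hpos p) k).ne']
    simp
  have hne : ∀ B : Finset S, (∏ p ∈ B, (p : ℕ) ^ k) ≠ 0 := fun B =>
    Finset.prod_ne_zero_iff.mpr fun p _ => pow_ne_zero _ (hS p p.2).ne_zero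
  have hsplit : (∑ p : S, v p * (k * Real.log p) : ℝ) =
      ∑ p with v p = 1, (k * Real.log (p : ℕ)) - ∑ p with v p = -1, (k * Real.log (p : ℕ)) := by
    rw [Finset.sum_filter, Finset.sum_filter, ← Finset.sum_sub_distrib]
    refine Finset.sum_congr rfl fun p _ => ?_
    rcases hv p with h | h | h <;> simp [h]
  by_cases hneg : ∃ q, v q = -1
  · obtain ⟨q, hq⟩ := hneg
    rw [Finset.prod_eq_zero (Finset.mem_univ q) (by simp [hq])]
    refine tsum_term_mul_ite_log_eq_zero fun n hn hl => ?_
    rw [hsplit, ← hlog, ← hlog, sub_eq_iff_eq_add, ← Real.log_mul (by exact_mod_cast hn)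
      (by exact_mod_cast hne _)] at hl
    have h2 := Real.log_injOn_pos (Set.mem_Ioi.mpr (by exact_mod_cast Nat.pos_of_ne_zero (hne _)))
      (Set.mem_Ioi.mpr (by exact_mod_cast Nat.pos_of_ne_zero (mul_ne_zero hn (hne _)))) hl
    have h3 : (∏ p with v p = 1, (p : ℕ) ^ k) = n * ∏ p with v p = -1, (p : ℕ) ^ k := by
      exact_mod_cast h2
    have h4 : (q : ℕ) ∣ ∏ p with v p = 1, (p : ℕ) ^ k := by
      rw [h3]
      refine Dvd.dvd.mul_left ?_ _
      exact (dvd_pow_self _ hk).trans (Finset.dvd_prod_of_mem (fun p : S => (p : ℕ) ^ k)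
        (by simpa using hq))
    obtain ⟨p, hp, hqp⟩ := ((hS q q.2).prime.dvd_finsetProd_iff _).mp h4
    have h5 := (Nat.prime_dvd_prime_iff_eq (hS q q.2) (hS p p.2)).mp
      ((hS q q.2).dvd_of_dvd_pow hqp)
    have : q = p := Subtype.ext h5
    simp only [Finset.mem_filter, Finset.mem_univ, true_and] at hp
    rw [← this, hq] at hp
    norm_num at hp
  · push Not at hneg
    have hempty : (Finset.univ.filter fun p => v p = -1) = ∅ := by
      simpa [Finset.filter_eq_empty_iff] using hneg
    rw [hempty, Finset.sum_empty, sub_zero, ← hlog] at hsplit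
    rw [tsum_term_mul_ite_log (hne _) hsplit]
    have himg : (∏ p with v p = 1, (p : ℕ) ^ k) =
        ∏ p ∈ (Finset.univ.filter fun p => v p = 1).map (Function.Embedding.subtype _), p ^ k := by
      simp
    have hsub : (Finset.univ.filter fun p => v p = 1).map (Function.Embedding.subtype _) ⊆ S := by
      intro x hx
      simp only [Finset.mem_map] at hx
      obtain ⟨y, _, rfl⟩ := hx
      exact y.2
    rw [himg, term_prod_prime_pow _ (fun p hp => hS p (hsub hp)) (hmul _ hsub), Finset.prod_map,
      Finset.prod_filter]
    refine Finset.prod_congr rfl fun p _ => ?_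
    rcases hv p with h | h | h
    · exact absurd h (hneg p)
    · simp [h]
    · simp [h]

lemma tendsto_gaussMean_mul_rieszKernel {H : ℂ → ℂ} {h : ℕ → ℂ} {C : ℝ}
    (hH : DifferentiableOn ℂ H {s | 1 / 2 < s.re}) (hC : ∀ s : ℂ, 1 / 2 < s.re → ‖H s‖ ≤ C)
    (hh : ∀ s : ℂ, 1 < s.re → LSeriesHasSum h s (H s)) {k : ℕ} (hk : k ≠ 0) {S : Finset ℕ}
    (hS : ∀ p ∈ S, p.Prime) (hmul : ∀ A ⊆ S, h (∏ p ∈ A, p ^ k) = ∏ p ∈ A, h (p ^ k))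
    (e : ℕ → ℂ) {s : ℂ} (hs : 1 / 2 < s.re) :
    Tendsto (gaussMean (fun u => H (s + u * Complex.I) * (rieszKernel S k e u : ℂ))) atTop
      (𝓝 (∏ p ∈ S, (1 + e p / 2 * LSeries.term h s (p ^ k)))) := by
  have h1 : ∀ T, gaussMean (fun u => H (s + u * Complex.I) * (rieszKernel S k e u : ℂ)) T =
      ∑ v ∈ Fintype.piFinset (fun _ : S => ({-1, 0, 1} : Finset ℤ)),
        (∏ p : S, rieszCoeff (e p) (v p)) * gaussMean (fun u => H (s + u * Complex.I) *
          Complex.exp (((∑ p : S, v p * (k * Real.log p)) * u : ℝ) * Complex.I)) T := by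
    intro T
    unfold gaussMean
    simp only [rieszKernel_eq_sum, Finset.mul_sum]
    rw [integral_finsetSum]
    · refine Finset.sum_congr rfl fun v _ => ?_
      rw [← integral_const_mul]
      congr 1
      ext x
      exact mul_left_comm _ _ _
    · intro v _
      have hc := continuous_vertical hH hs
      simp only [mul_left_comm (H _)]
      refine Integrable.const_mul ?_ _
      refine integrable_gaussian_of_continuous_of_bounded (C := C)
        (f := fun u => H (s + (u : ℂ) * Complex.I) * Complex.exp
          (((∑ p : S, v p * (k * Real.log p)) * u : ℝ) * Complex.I))
        (hc.mul (by fun_prop)) (fun u => ?_) T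
      rw [norm_mul, norm_exp_ofReal_mul_ofReal_mul_I, mul_one]
      exact hC _ (by simpa using hs)
  rw [show (gaussMean fun u => H (s + u * Complex.I) * (rieszKernel S k e u : ℂ)) = _ from funext h1]
  have h2 : (∏ p ∈ S, (1 + e p / 2 * LSeries.term h s (p ^ k))) =
      ∑ v ∈ Fintype.piFinset (fun _ : S => ({-1, 0, 1} : Finset ℤ)),
        (∏ p : S, rieszCoeff (e p) (v p)) * ∑' n, LSeries.term h s n *
          if (∑ p : S, v p * (k * Real.log p) : ℝ) = Real.log n then 1 else 0 := by
    have h3 : ∀ v ∈ Fintype.piFinset (fun _ : S => ({-1, 0, 1} : Finset ℤ)),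
        (∏ p : S, rieszCoeff (e p) (v p)) * (∑' n, LSeries.term h s n *
          if (∑ p : S, v p * (k * Real.log p) : ℝ) = Real.log n then 1 else 0) =
        ∏ p : S, (rieszCoeff (e p) (v p) *
          if v p = 0 then 1 else if v p = 1 then LSeries.term h s (p ^ k) else 0) := by
      intro v hv
      rw [tsum_term_mul_ite_riesz hk hS hmul s v (fun p => by
        simpa using Fintype.mem_piFinset.mp hv p), Finset.prod_mul_distrib]
    rw [Finset.sum_congr rfl h3, ← Finset.prod_univ_sum (fun _ : S => ({-1, 0, 1} : Finset ℤ))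
      (fun p j => rieszCoeff (e p) j *
          if j = 0 then 1 else if j = 1 then LSeries.term h s ((p : ℕ) ^ k) else 0),
      ← Finset.prod_coe_sort S]
    refine Finset.prod_congr rfl fun p _ => ?_
    simp [rieszCoeff]
  rw [h2]
  exact tendsto_finsetSum _ fun v _ => (tendsto_gaussMean_mul_exp hH hC hh _ hs).const_mul _

/-- The kernel is nonnegative and, by the same limit formula applied to `H = 1`, has asymptotic mean
1. A mean of `H` against it is thus at most `C` in the limit. -/
lemma norm_prod_riesz_le {H : ℂ → ℂ} {h : ℕ → ℂ} {C : ℝ}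
    (hH : DifferentiableOn ℂ H {s | 1 / 2 < s.re}) (hC : ∀ s : ℂ, 1 / 2 < s.re → ‖H s‖ ≤ C)
    (hh : ∀ s : ℂ, 1 < s.re → LSeriesHasSum h s (H s)) {k : ℕ} (hk : k ≠ 0) {S : Finset ℕ}
    (hS : ∀ p ∈ S, p.Prime) (hmul : ∀ A ⊆ S, h (∏ p ∈ A, p ^ k) = ∏ p ∈ A, h (p ^ k))
    {e : ℕ → ℂ} (he : ∀ p, ‖e p‖ ≤ 1) {s : ℂ} (hs : 1 / 2 < s.re) :
    ‖∏ p ∈ S, (1 + e p / 2 * LSeries.term h s (p ^ k))‖ ≤ C := by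
  have t1 := tendsto_gaussMean_mul_rieszKernel hH hC hh hk hS hmul e hs
  have hpk : ∀ p ∈ S, p ^ k ≠ 1 := fun p hp h => by
    have := (hS p hp).one_lt
    simp [hk] at h
    omega
  have t2 := tendsto_gaussMean_mul_rieszKernel (H := fun _ => 1) (h := (1 : ArithmeticFunction ℂ))
    (C := 1) (differentiableOn_const 1) (by simp) (fun s _ => LSeriesHasSum_one_arith s) hk hS
    (fun A hA => by
      rcases A.eq_empty_or_nonempty with rfl | ⟨q, hq⟩
      · simp
      · rw [Finset.prod_eq_zero (f := fun p => (1 : ArithmeticFunction ℂ) (p ^ k)) hq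
          (ArithmeticFunction.one_apply_ne (hpk q (hA hq)))]
        refine ArithmeticFunction.one_apply_ne fun h => hpk q (hA hq) ?_
        exact Nat.eq_one_of_dvd_one (h ▸ Finset.dvd_prod_of_mem _ hq)) e hs
  have h1 : ∏ p ∈ S, (1 + e p / 2 * LSeries.term (1 : ArithmeticFunction ℂ) s (p ^ k)) = 1 := by
    refine Finset.prod_eq_one fun p hp => ?_
    simp [LSeries.term_def, ArithmeticFunction.one_apply_ne (hpk p hp)]
  rw [h1] at t2
  have t3 := t2.norm.const_mul C
  rw [norm_one, mul_one] at t3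
  refine le_of_tendsto_of_tendsto' t1.norm t3 fun T => ?_
  have hK := rieszKernel_nonneg (S := S) (k := k) he
  have hnn : ∀ u, ‖(rieszKernel S k e u : ℂ)‖ = rieszKernel S k e u := fun u => by
    rw [Complex.norm_real]; exact abs_of_nonneg (hK u)
  have hbd : ∀ u, rieszKernel S k e u ≤ ∏ p ∈ S, (2 : ℝ) := by
    intro u
    refine Finset.prod_le_prod (fun p _ => ?_) (fun p _ => ?_)
    all_goals
      have h1 := Complex.abs_re_le_norm (e p * Complex.exp ((k * Real.log p * u : ℝ) * Complex.I))
      rw [norm_mul, norm_exp_ofReal_mul_ofReal_mul_I, mul_one] at h1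
      have := abs_le.mp (h1.trans (he p))
      linarith
  have hint : Integrable (fun v => rieszKernel S k e (T * v)) (gaussianReal 0 1) := by
    refine Integrable.of_bound (C := ∏ p ∈ S, (2 : ℝ)) ?_ (Eventually.of_forall fun v => ?_)
    · exact ((continuous_rieszKernel S k e).comp (continuous_const_mul T)).aestronglyMeasurable
    · rw [Real.norm_of_nonneg (hK _)]
      exact hbd _
  unfold gaussMean
  simp only [one_mul]
  rw [integral_complex_ofReal, Complex.norm_real,
    Real.norm_of_nonneg (integral_nonneg fun v => hK _), ← integral_const_mul]
  refine norm_integral_le_of_norm_le (hint.const_mul C) (Eventually.of_forall fun v => ?_)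
  rw [norm_mul, hnn]
  exact mul_le_mul_of_nonneg_right (hC _ (by simpa using hs)) (hK _)

/-! ### Absolute convergence on the critical line -/

lemma one_add_sum_le_prod_one_add (S : Finset ℕ) (f : ℕ → ℝ) (hf : ∀ p, 0 ≤ f p) :
    1 + ∑ p ∈ S, f p ≤ ∏ p ∈ S, (1 + f p) := by
  induction S using Finset.induction_on with
  | empty => simp
  | insert p S hp ih =>
    rw [Finset.sum_insert hp, Finset.prod_insert hp]
    nlinarith [hf p, Finset.sum_nonneg fun q (_ : q ∈ S) => hf q]

lemma exists_norm_le_one_mul_eq_norm (z : ℂ) : ∃ e : ℂ, ‖e‖ ≤ 1 ∧ e * z = ‖z‖ := by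
  rcases eq_or_ne z 0 with rfl | hz
  · exact ⟨0, by simp, by simp⟩
  · have : (‖z‖ : ℂ) ≠ 0 := by exact_mod_cast (norm_pos_iff.mpr hz).ne'
    refine ⟨‖z‖ / z, ?_, div_mul_cancel₀ _ hz⟩
    rw [norm_div, Complex.norm_real, norm_norm, div_self (norm_pos_iff.mpr hz).ne']

/-- The prime power coefficients of a bounded multiplicative Dirichlet series are absolutely
summable on the boundary line. -/
lemma sum_norm_prime_pow_le {H : ℂ → ℂ} {h : ℕ → ℂ} {C : ℝ}
    (hH : DifferentiableOn ℂ H {s | 1 / 2 < s.re}) (hC : ∀ s : ℂ, 1 / 2 < s.re → ‖H s‖ ≤ C)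
    (hh : ∀ s : ℂ, 1 < s.re → LSeriesHasSum h s (H s)) {k : ℕ} (hk : k ≠ 0) {S : Finset ℕ}
    (hS : ∀ p ∈ S, p.Prime) (hmul : ∀ A ⊆ S, h (∏ p ∈ A, p ^ k) = ∏ p ∈ A, h (p ^ k)) :
    ∑ p ∈ S, ‖LSeries.term h (1 / 2) (p ^ k)‖ ≤ 2 * C := by
  have hlt : ∀ x : ℝ, 1 / 2 < x → ∑ p ∈ S, ‖LSeries.term h x (p ^ k)‖ ≤ 2 * C := by
    intro x hx
    -- The phases make every factor `1 + ‖·‖ / 2`, so the bound on the product controls the sum.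
    choose e he1 he2 using fun p : ℕ => exists_norm_le_one_mul_eq_norm (LSeries.term h x (p ^ k))
    have h1 := norm_prod_riesz_le hH hC hh hk hS hmul he1 (s := x) (by simpa using hx)
    have h2 : ∏ p ∈ S, (1 + e p / 2 * LSeries.term h x (p ^ k)) =
        ((∏ p ∈ S, (1 + ‖LSeries.term h x (p ^ k)‖ / 2) : ℝ) : ℂ) := by
      push_cast
      refine Finset.prod_congr rfl fun p _ => ?_
      rw [← he2]
      ring
    rw [h2, Complex.norm_real] at h1
    have h3 := one_add_sum_le_prod_one_add S (fun p => ‖LSeries.term h x (p ^ k)‖ / 2)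
      (fun p => by positivity)
    have h4 := h3.trans ((le_abs_self _).trans h1)
    rw [← Finset.sum_div] at h4
    linarith
  have hcont : Tendsto (fun x : ℝ => ∑ p ∈ S, ‖LSeries.term h x (p ^ k)‖) (𝓝[>] (1 / 2))
      (𝓝 (∑ p ∈ S, ‖LSeries.term h (1 / 2) (p ^ k)‖)) := by
    refine tendsto_finsetSum _ fun p hp => ?_
    have h0 : ((p ^ k : ℕ) : ℂ) ≠ 0 := by
      exact_mod_cast pow_ne_zero _ (hS p hp).ne_zero
    have hc : Continuous fun s : ℂ => ‖LSeries.term h s (p ^ k)‖ := by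
      simp only [LSeries.term_of_ne_zero (pow_ne_zero k (hS p hp).ne_zero)]
      refine (continuous_const.div (continuous_const.cpow continuous_id fun s => ?_) fun s => ?_).norm
      · simp only [Nat.cast_pow] at *
        refine Or.inl ?_
        exact_mod_cast pow_pos (hS p hp).pos k
      · simp [Complex.cpow_eq_zero_iff, (hS p hp).ne_zero]
    have := ((hc.comp Complex.continuous_ofReal).tendsto (1 / 2)).mono_left
      (nhdsWithin_le_nhds (s := Set.Ioi (1 / 2)))
    simpa [Function.comp_def] using this
  exact le_of_tendsto hcont (eventually_mem_nhdsWithin.mono fun x hx => hlt x hx)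

lemma term_dirichletExp_prime_pow {c : ArithmeticFunction ℂ} {s : ℂ} (hc : LSeriesSummable c s)
    {p : ℕ} (hp : p.Prime) (k : ℕ) (w : ℂ) :
    k * LSeries.term (dirichletExp c) w (p ^ k) =
      ∑ j ∈ Finset.range (k + 1), j * LSeries.term c w (p ^ j) *
        LSeries.term (dirichletExp c) w (p ^ (k - j)) := by
  have h0 : ∀ j, p ^ j ≠ 0 := fun j => pow_ne_zero _ hp.ne_zero
  have hw : ∀ j, ((p ^ j : ℕ) : ℂ) ^ w ≠ 0 := fun j => by
    simp [Complex.cpow_eq_zero_iff, hp.ne_zero]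
  rw [LSeries.term_of_ne_zero (h0 k), ← mul_div_assoc, dirichletExp_prime_pow hc hp,
    Finset.sum_div]
  refine Finset.sum_congr rfl fun j hj => ?_
  have hj' : j + (k - j) = k := by have := Finset.mem_range.mp hj; omega
  have h1 : ((p ^ k : ℕ) : ℂ) ^ w = ((p ^ j : ℕ) : ℂ) ^ w * ((p ^ (k - j) : ℕ) : ℂ) ^ w := by
    rw [← Complex.natCast_mul_natCast_cpow, ← Nat.cast_mul, ← pow_add, hj']
  rw [LSeries.term_of_ne_zero (h0 j), LSeries.term_of_ne_zero (h0 (k - j)), h1]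
  have := hw j
  have := hw (k - j)
  field_simp

/-- Induction on `k`: the recursion expresses `k c(p^k)` through `exp c` at `p^k`, which is summable
over `p`, and products of earlier `c(p^j)` with values bounded by `M`. -/
lemma summable_term_prime_pow {c : ArithmeticFunction ℂ} {s : ℂ} (hc : LSeriesSummable c s)
    (hc1 : c 1 = 0) {w : ℂ} {M : ℝ}
    (hM : ∀ k : ℕ, k ≠ 0 → ∀ S : Finset ℕ, (∀ p ∈ S, p.Prime) →
      ∑ p ∈ S, ‖LSeries.term (dirichletExp c) w (p ^ k)‖ ≤ M) (k : ℕ) :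
    Summable fun p : Nat.Primes => LSeries.term c w ((p : ℕ) ^ k) := by
  have hx : ∀ k : ℕ, k ≠ 0 →
      Summable fun p : Nat.Primes => LSeries.term (dirichletExp c) w ((p : ℕ) ^ k) := by
    intro k hk
    apply Summable.of_norm
    refine summable_of_sum_le (c := M) (fun _ => norm_nonneg _) fun u => ?_
    have := hM k hk (u.map ⟨fun p : Nat.Primes => (p : ℕ), Nat.Primes.coe_nat_injective⟩) (by
      intro p hp
      obtain ⟨q, _, rfl⟩ := Finset.mem_map.mp hp
      exact q.2)
    rwa [Finset.sum_map] at this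
  have hxM : ∀ k : ℕ, k ≠ 0 → ∀ p : Nat.Primes,
      ‖LSeries.term (dirichletExp c) w ((p : ℕ) ^ k)‖ ≤ M := fun k hk p => by
    simpa using hM k hk {(p : ℕ)} (by simpa using p.2)
  induction k using Nat.strong_induction_on with
  | _ k ih =>
  rcases eq_or_ne k 0 with rfl | hk
  · simp [hc1]
  have hk' : (k : ℂ) ≠ 0 := by exact_mod_cast hk
  have h1 : ∀ p : Nat.Primes, (k : ℂ) * LSeries.term c w ((p : ℕ) ^ k) =
      k * LSeries.term (dirichletExp c) w ((p : ℕ) ^ k) -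
        ∑ j ∈ Finset.range k, j * LSeries.term c w ((p : ℕ) ^ j) *
          LSeries.term (dirichletExp c) w ((p : ℕ) ^ (k - j)) := by
    intro p
    rw [term_dirichletExp_prime_pow hc p.2, Finset.sum_range_succ, add_sub_cancel_left]
    simp [LSeries.term_def, dirichletExp_one hc1]
  rw [← summable_mul_left_iff hk']
  simp only [h1]
  refine ((hx k hk).mul_left _).sub (summable_sum fun j hj => ?_)
  have hjk : k - j ≠ 0 := by have := Finset.mem_range.mp hj; omega
  refine Summable.of_norm_bounded
    (((ih j (Finset.mem_range.mp hj)).norm.mul_left (j : ℝ)).mul_right M) fun p => ?_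
  rw [norm_mul, norm_mul, Complex.norm_natCast]
  gcongr
  exact hxM _ hjk p

/-- The choice of `N` makes the first `N` exponents pay for `p ^ (-2)`, summable over primes; each
further exponent gains a geometric factor, estimated by its value at `p = 2`. -/
lemma norm_term_prime_pow_le {c : ArithmeticFunction ℂ} {θ K : ℝ} (hθ : θ < 1 / 2) (hK : 0 ≤ K)
    (hb : ∀ n : ℕ, 1 ≤ n → ‖c n‖ ≤ K * (n : ℝ) ^ θ) {N : ℕ} (hN : 2 ≤ N * (1 / 2 - θ))
    {p : ℕ} (hp : p.Prime) (i : ℕ) :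
    ‖LSeries.term c (1 / 2) (p ^ (N + i))‖ ≤
      K * (p : ℝ) ^ (-2 : ℝ) * ((2 : ℝ) ^ (-(1 / 2 - θ))) ^ i := by
  have hp0 : (0 : ℝ) < p := by exact_mod_cast hp.pos
  have hp1 : (1 : ℝ) ≤ p := by exact_mod_cast hp.one_le
  have hp2 : (2 : ℝ) ≤ p := by exact_mod_cast hp.two_le
  have hpk : (0 : ℝ) < (p : ℝ) ^ (N + i) := pow_pos hp0 _
  rw [LSeries.norm_term_eq, if_neg (pow_ne_zero _ hp.ne_zero)]
  rw [show ((1 / 2 : ℂ)).re = 1 / 2 by norm_num]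
  have h1 := hb (p ^ (N + i)) (Nat.one_le_pow _ _ hp.pos)
  calc ‖c (p ^ (N + i))‖ / ((p ^ (N + i) : ℕ) : ℝ) ^ (1 / 2 : ℝ)
      ≤ K * ((p ^ (N + i) : ℕ) : ℝ) ^ θ / ((p ^ (N + i) : ℕ) : ℝ) ^ (1 / 2 : ℝ) := by gcongr
    _ = K * (p : ℝ) ^ (-((N + i) * (1 / 2 - θ))) := by
      rw [mul_div_assoc, Nat.cast_pow, ← Real.rpow_sub hpk, ← Real.rpow_natCast, ← Real.rpow_mul hp0.le]
      push_cast
      ring_nf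
    _ = K * ((p : ℝ) ^ (-(N * (1 / 2 - θ))) * ((p : ℝ) ^ (-(1 / 2 - θ))) ^ i) := by
      rw [← Real.rpow_natCast, ← Real.rpow_mul hp0.le, ← Real.rpow_add hp0]
      ring_nf
    _ ≤ K * ((p : ℝ) ^ (-2 : ℝ) * ((2 : ℝ) ^ (-(1 / 2 - θ))) ^ i) := by
      gcongr K * (?_ * ?_ ^ i)
      · exact Real.rpow_le_rpow_of_exponent_le hp1 (by linarith)
      · exact Real.rpow_le_rpow_of_nonpos two_pos hp2 (by linarith)
    _ = _ := by ring

/-- A Dirichlet series over prime powers with coefficients `O(n ^ θ)`, `θ < 1 / 2`, converges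
absolutely at `1 / 2` as soon as its sums over `k`-th powers of primes do. -/
lemma LSeriesSummable_half_of_prime_pow {c : ArithmeticFunction ℂ} {θ K : ℝ} (hθ : θ < 1 / 2)
    (hK : 0 ≤ K) (hb : ∀ n : ℕ, 1 ≤ n → ‖c n‖ ≤ K * (n : ℝ) ^ θ)
    (hsupp : ∀ n, ¬ IsPrimePow n → c n = 0)
    (hsum : ∀ k : ℕ, Summable fun p : Nat.Primes => LSeries.term c (1 / 2) ((p : ℕ) ^ k)) :
    LSeriesSummable c (1 / 2) := by
  obtain ⟨N, hN⟩ := exists_nat_ge (2 / (1 / 2 - θ))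
  rw [div_le_iff₀ (by linarith)] at hN
  have hZ : Summable fun p : Nat.Primes => ((p : ℕ) : ℝ) ^ (-2 : ℝ) :=
    (Real.summable_nat_rpow.mpr (by norm_num : (-2 : ℝ) < -1)).comp_injective
      Nat.Primes.coe_nat_injective
  have hr0 : (0 : ℝ) ≤ (2 : ℝ) ^ (-(1 / 2 - θ)) := by positivity
  have hr1 : (2 : ℝ) ^ (-(1 / 2 - θ)) < 1 :=
    Real.rpow_lt_one_of_one_lt_of_neg one_lt_two (by linarith)
  have h2 : Summable fun q : ℕ × Nat.Primes =>
      ‖LSeries.term c (1 / 2) ((q.2 : ℕ) ^ (q.1 + 1))‖ := by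
    rw [summable_prod_of_nonneg fun _ => norm_nonneg _]
    refine ⟨fun k => (hsum (k + 1)).norm, ?_⟩
    -- The finitely many exponents below the threshold are covered individually by `hsum`; only the
    -- tail needs a uniform estimate.
    refine (summable_nat_add_iff N).mp ?_
    refine Summable.of_nonneg_of_le (fun i => tsum_nonneg fun _ => norm_nonneg _) (fun i => ?_)
      ((summable_geometric_of_lt_one hr0 hr1).mul_left
        (K * (∑' p : Nat.Primes, ((p : ℕ) : ℝ) ^ (-2 : ℝ)) * (2 : ℝ) ^ (-(1 / 2 - θ))))
    rw [mul_assoc, ← pow_succ', ← tsum_mul_left, ← tsum_mul_right]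
    refine Summable.tsum_le_tsum (fun p => ?_) (hsum (i + N + 1)).norm
      ((hZ.mul_left K).mul_right _)
    have := norm_term_prime_pow_le hθ hK hb hN p.2 (i + 1)
    rwa [show N + (i + 1) = i + N + 1 by ring] at this
  have h3 : Summable fun q : Nat.Primes × ℕ =>
      ‖LSeries.term c (1 / 2) ((q.1 : ℕ) ^ (q.2 + 1))‖ :=
    h2.prod_symm
  have h4 : Summable fun n : {n : ℕ // IsPrimePow n} => ‖LSeries.term c (1 / 2) n‖ := by
    rw [← Nat.Primes.prodNatEquiv.summable_iff]
    exact h3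
  apply Summable.of_norm
  refine (Function.Injective.summable_iff Subtype.val_injective fun n hn => ?_).mp h4
  have : ¬ IsPrimePow n := fun h => hn ⟨⟨n, h⟩, rfl⟩
  simp [LSeries.term_def, hsupp n this]

/-! ### Second differences of gamma factors -/

lemma GammaSeq_sq_div {w h : ℂ} (hw : 0 < w.re) (hh : h.re = 0) {n : ℕ} (hn : n ≠ 0) :
    Complex.GammaSeq w n ^ 2 / (Complex.GammaSeq (w - h) n * Complex.GammaSeq (w + h) n) =
      ∏ j ∈ Finset.range (n + 1), (1 + -(h ^ 2 / (w + j) ^ 2)) := by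
  have hne : ∀ x : ℂ, x.re = 0 → ∀ j : ℕ, w + x + j ≠ 0 := by
    intro x hx j h0
    have := congrArg Complex.re h0
    simp [hx] at this
    have : (0 : ℝ) ≤ j := Nat.cast_nonneg j
    linarith
  have h1 : ∀ j : ℕ, w + j ≠ 0 := fun j => by simpa using hne 0 rfl j
  have h2 : ∀ j : ℕ, w + h + j ≠ 0 := hne h hh
  have h3 : ∀ j : ℕ, w - h + j ≠ 0 := fun j => by
    simpa [sub_eq_add_neg] using hne (-h) (by simp [hh]) j
  have hp : ∀ x : ℂ, (n : ℂ) ^ x ≠ 0 := fun x => by simp [Complex.cpow_eq_zero_iff, hn]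
  have hf : (n.factorial : ℂ) ≠ 0 := by exact_mod_cast n.factorial_ne_zero
  have hpow : (n : ℂ) ^ w * (n : ℂ) ^ w = (n : ℂ) ^ (w - h) * (n : ℂ) ^ (w + h) := by
    have hn' : (n : ℂ) ≠ 0 := by exact_mod_cast hn
    rw [← Complex.cpow_add _ _ hn', ← Complex.cpow_add _ _ hn']
    ring_nf
  have hprod : ∏ j ∈ Finset.range (n + 1), (1 + -(h ^ 2 / (w + j) ^ 2)) =
      (∏ j ∈ Finset.range (n + 1), (w - h + j)) * (∏ j ∈ Finset.range (n + 1), (w + h + j)) /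
        (∏ j ∈ Finset.range (n + 1), (w + j)) ^ 2 := by
    rw [← Finset.prod_mul_distrib, ← Finset.prod_pow, ← Finset.prod_div_distrib]
    refine Finset.prod_congr rfl fun j _ => ?_
    have := h1 j
    field_simp
    ring
  have p1 := Finset.prod_ne_zero_iff.mpr fun j (_ : j ∈ Finset.range (n + 1)) => h1 j
  have p2 := Finset.prod_ne_zero_iff.mpr fun j (_ : j ∈ Finset.range (n + 1)) => h2 j
  have p3 := Finset.prod_ne_zero_iff.mpr fun j (_ : j ∈ Finset.range (n + 1)) => h3 j
  rw [hprod]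
  unfold Complex.GammaSeq
  have q1 := hp (w - h)
  have q2 := hp (w + h)
  have q3 := hp w
  rw [div_eq_div_iff (by positivity) (by positivity)]
  field_simp
  linear_combination hpow

/-- Limit of `|∏ (1 + a_j) - 1| ≤ exp (∑ |a_j|) - 1` along Euler's product. As `h` is purely
imaginary, `w ± h` stay in the right half-plane, where `Γ` has no poles or zeros. -/
lemma norm_Gamma_sq_div_sub_one_le {w h : ℂ} (hw : 0 < w.re) (hh : h.re = 0) {b : ℕ → ℝ}
    (hb : Summable b) (hle : ∀ j : ℕ, ‖h ^ 2 / (w + j) ^ 2‖ ≤ b j) :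
    ‖Complex.Gamma w ^ 2 / (Complex.Gamma (w - h) * Complex.Gamma (w + h)) - 1‖ ≤
      Real.exp (∑' j, b j) - 1 := by
  have hG : Complex.Gamma (w - h) * Complex.Gamma (w + h) ≠ 0 :=
    mul_ne_zero (Complex.Gamma_ne_zero_of_re_pos (by simpa [hh] using hw))
      (Complex.Gamma_ne_zero_of_re_pos (by simpa [hh] using hw))
  have h1 := (((Complex.GammaSeq_tendsto_Gamma w).pow 2).div
    ((Complex.GammaSeq_tendsto_Gamma (w - h)).mul (Complex.GammaSeq_tendsto_Gamma (w + h))) hG)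
  refine le_of_tendsto (h1.sub_const 1).norm ?_
  filter_upwards [eventually_ne_atTop 0] with n hn
  simp only [Pi.div_apply]
  rw [GammaSeq_sq_div hw hh hn]
  refine (Finset.norm_prod_one_add_sub_one_le _ _).trans ?_
  gcongr
  simp only [norm_neg]
  exact (Finset.sum_le_sum fun j _ => hle j).trans
    (hb.sum_le_tsum _ fun j _ => (norm_nonneg _).trans (hle j))

/-- Takes the place of Stirling's formula: `|w + j|² ≥ j² + (Im w)²`, and `∑ 1 / (j² + Y²)` tends to
0 as `Y` grows, by dominated convergence. -/
lemma tendsto_Gamma_sq_div {ι : Type*} {l : Filter ι} {w : ι → ℂ} {h : ℂ} (hw : ∀ i, 0 < (w i).re)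
    (hh : h.re = 0) (him : Tendsto (fun i => |(w i).im|) l atTop) :
    Tendsto (fun i => Complex.Gamma (w i) ^ 2 /
      (Complex.Gamma (w i - h) * Complex.Gamma (w i + h))) l (𝓝 1) := by
  have hsum : Summable fun j : ℕ => ‖h‖ ^ 2 * (1 / ((j : ℝ) ^ 2 + 1)) := by
    refine Summable.mul_left _ (Summable.of_nonneg_of_le (fun j => by positivity) (fun j => ?_)
      (((summable_nat_add_iff 1).mpr (Real.summable_one_div_nat_pow.mpr
        (one_lt_two))).mul_left 2))
    push_cast
    rw [mul_one_div, div_le_div_iff₀ (by positivity) (by positivity)]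
    nlinarith [sq_nonneg ((j : ℝ) - 1)]
  have hle : ∀ (Y : ℝ), 1 ≤ Y → ∀ j : ℕ, ‖h‖ ^ 2 * (1 / ((j : ℝ) ^ 2 + Y ^ 2)) ≤
      ‖h‖ ^ 2 * (1 / ((j : ℝ) ^ 2 + 1)) := by
    intro Y hY j
    gcongr
    nlinarith
  have hlim : Tendsto (fun Y : ℝ => ∑' j : ℕ, ‖h‖ ^ 2 * (1 / ((j : ℝ) ^ 2 + Y ^ 2))) atTop
      (𝓝 (∑' _ : ℕ, 0)) := by
    refine tendsto_tsum_of_dominated_convergence hsum (fun j => ?_) ?_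
    · have h1 : Tendsto (fun Y : ℝ => (j : ℝ) ^ 2 + Y ^ 2) atTop atTop :=
        tendsto_atTop_add_const_left _ _ (tendsto_pow_atTop two_ne_zero)
      simpa using (h1.inv_tendsto_atTop).const_mul (‖h‖ ^ 2)
    · filter_upwards [eventually_ge_atTop 1] with Y hY j
      rw [Real.norm_of_nonneg (by positivity)]
      exact hle Y hY j
  rw [tsum_zero] at hlim
  have h2 := ((Real.continuous_exp.tendsto 0).comp (hlim.comp him)).sub_const 1
  rw [Real.exp_zero, sub_self] at h2
  rw [tendsto_iff_norm_sub_tendsto_zero]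
  refine squeeze_zero' (Eventually.of_forall fun i => norm_nonneg _) ?_ h2
  filter_upwards [him.eventually_ge_atTop 1] with i hi
  refine norm_Gamma_sq_div_sub_one_le (hw i) hh
    (Summable.of_nonneg_of_le (fun j => by positivity) (hle _ hi) hsum) fun j => ?_
  rw [norm_div, norm_pow, norm_pow, div_eq_mul_one_div]
  refine mul_le_mul_of_nonneg_left (one_div_le_one_div_of_le ?_ ?_) (by positivity)
  · have : 0 < |(w i).im| := lt_of_lt_of_le one_pos hi
    positivity
  · rw [← Complex.normSq_eq_norm_sq, Complex.normSq_apply, sq_abs]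
    simp only [Complex.add_re, Complex.natCast_re, Complex.add_im, Complex.natCast_im, add_zero]
    have := hw i
    have : (0 : ℝ) ≤ j := Nat.cast_nonneg j
    nlinarith

/-- The multiplicative second difference of `f` with step `τ`. -/
noncomputable def secondRatio (τ : ℝ) (f : ℝ → ℂ) (t : ℝ) : ℂ :=
  f t ^ 2 / (f (t - τ) * f (t + τ))

lemma secondRatio_mul (τ : ℝ) (f g : ℝ → ℂ) (t : ℝ) :
    secondRatio τ (fun t => f t * g t) t = secondRatio τ f t * secondRatio τ g t := by
  simp only [secondRatio]
  rw [div_mul_div_comm]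
  ring

lemma secondRatio_prod {ι : Type*} (S : Finset ι) (τ : ℝ) (f : ι → ℝ → ℂ) (t : ℝ) :
    secondRatio τ (fun t => ∏ i ∈ S, f i t) t = ∏ i ∈ S, secondRatio τ (f i) t := by
  simp only [secondRatio]
  rw [← Finset.prod_mul_distrib, ← Finset.prod_pow, Finset.prod_div_distrib]

lemma secondRatio_conj (τ : ℝ) (f : ℝ → ℂ) (t : ℝ) :
    secondRatio τ (fun t => starRingEnd ℂ (f t)) t = starRingEnd ℂ (secondRatio τ f t) := by
  simp [secondRatio]

lemma secondRatio_const (τ : ℝ) {a : ℂ} (ha : a ≠ 0) (t : ℝ) :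
    secondRatio τ (fun _ => a) t = 1 := by
  simp only [secondRatio]
  field_simp

lemma secondRatio_exp (τ : ℝ) (f : ℝ → ℂ) (t : ℝ) :
    secondRatio τ (fun t => Complex.exp (f t)) t =
      Complex.exp (2 * f t - f (t - τ) - f (t + τ)) := by
  simp only [secondRatio]
  rw [← Complex.exp_add, ← Complex.exp_nat_mul, ← Complex.exp_sub]
  push_cast
  ring_nf

open Selberg in
lemma gammaFactor_ne_zero {r : ℕ} {Q : ℝ} {lam : Fin r → ℝ} {mu : Fin r → ℂ} (hQ : 0 < Q)
    (hlam : ∀ j, 0 < lam j) (hmu : ∀ j, 0 ≤ (mu j).re) {s : ℂ} (hs : 0 < s.re) :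
    gammaFactor Q lam mu s ≠ 0 := by
  refine mul_ne_zero ?_ (Finset.prod_ne_zero_iff.mpr fun j _ => ?_)
  · simp [Complex.cpow_eq_zero_iff, hQ.ne']
  · refine Complex.Gamma_ne_zero_of_re_pos ?_
    have := mul_pos (hlam j) hs
    simpa using add_pos_of_pos_of_nonneg this (hmu j)

-- The factor `Q ^ s` is the exponential of an affine function of `t`, so its second ratio is
-- exactly 1; each gamma factor is sampled with the imaginary step `lam j * τ * I`.
open Selberg in
lemma tendsto_secondRatio_gammaFactor {r : ℕ} {Q : ℝ} {lam : Fin r → ℝ} {mu : Fin r → ℂ}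
    (hQ : 0 < Q) (hlam : ∀ j, 0 < lam j) (hmu : ∀ j, 0 ≤ (mu j).re) (τ : ℝ) :
    Tendsto (secondRatio τ fun t => gammaFactor Q lam mu (1 / 2 + t * Complex.I)) (cocompact ℝ)
      (𝓝 1) := by
  have h1 : ∀ t, secondRatio τ (fun t => gammaFactor Q lam mu (1 / 2 + t * Complex.I)) t =
      ∏ j, secondRatio τ (fun t => Complex.Gamma (lam j * (1 / 2 + t * Complex.I) + mu j)) t := by
    intro t
    unfold gammaFactor
    rw [secondRatio_mul, secondRatio_prod]
    convert one_mul _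
    have hQ' : (Q : ℂ) ≠ 0 := by exact_mod_cast hQ.ne'
    simp only [Complex.cpow_def_of_ne_zero hQ', secondRatio_exp]
    rw [← Complex.exp_zero]
    congr 1
    push_cast
    ring
  rw [show secondRatio τ (fun t => gammaFactor Q lam mu (1 / 2 + t * Complex.I)) = _ from funext h1]
  suffices h : ∀ j, Tendsto (secondRatio τ fun t =>
      Complex.Gamma (lam j * (1 / 2 + t * Complex.I) + mu j)) (cocompact ℝ) (𝓝 1) by
    simpa using tendsto_finsetProd Finset.univ fun j _ => h j
  intro j
  have h2 := tendsto_Gamma_sq_div (l := cocompact ℝ)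
    (w := fun t : ℝ => lam j * (1 / 2 + t * Complex.I) + mu j) (h := lam j * τ * Complex.I)
    (fun t => by
      have := mul_pos (hlam j) (show (0 : ℝ) < 1 / 2 by norm_num)
      simpa using add_pos_of_pos_of_nonneg this (hmu j))
    (by simp) (by
      have h3 : Tendsto (fun t : ℝ => lam j * |t| - |(mu j).im|) (cocompact ℝ) atTop := by
        have : Tendsto (fun t : ℝ => |t|) (cocompact ℝ) atTop := tendsto_norm_cocompact_atTop
        exact tendsto_atTop_add_const_right _ _ (this.const_mul_atTop (hlam j))
      refine tendsto_atTop_mono (fun t => ?_) h3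
      have h4 : (lam j * (1 / 2 + t * Complex.I) + mu j : ℂ).im = lam j * t + (mu j).im := by simp
      rw [h4]
      have := abs_sub_abs_le_abs_sub (lam j * t) (-(mu j).im)
      rwa [abs_neg, sub_neg_eq_add, abs_mul, abs_of_pos (hlam j)] at this)
  refine h2.congr fun t => ?_
  simp only [secondRatio]
  push_cast
  ring_nf

/-! ### Almost periodic functions with prescribed behaviour at infinity -/

lemma tendsto_gaussMean_tsum {a : ℕ → ℂ} (ha : Summable a) (l : ℕ → ℝ) :
    Tendsto (gaussMean fun u => ∑' n, a n * Complex.exp ((l n * u : ℝ) * Complex.I)) atTop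
      (𝓝 (∑' n, a n * if l n = 0 then 1 else 0)) := by
  have hnorm : ∀ (n : ℕ) (u : ℝ), ‖a n * Complex.exp ((l n * u : ℝ) * Complex.I)‖ = ‖a n‖ := by
    intro n u
    rw [norm_mul, norm_exp_ofReal_mul_ofReal_mul_I, mul_one]
  have hcont : ∀ n : ℕ, Continuous fun u : ℝ => a n * Complex.exp ((l n * u : ℝ) * Complex.I) :=
    fun n => by fun_prop
  have h1 : ∀ T, gaussMean (fun u => ∑' n, a n * Complex.exp ((l n * u : ℝ) * Complex.I)) T =
      ∑' n, a n * (Real.exp (-(T * l n) ^ 2 / 2) : ℂ) := by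
    intro T
    have key := hasSum_integral_of_summable_integral_norm (μ := gaussianReal 0 1)
      (F := fun n (v : ℝ) => a n * Complex.exp ((l n * (T * v) : ℝ) * Complex.I))
      (fun n => integrable_gaussian_of_continuous_of_bounded (hcont n) (fun u => (hnorm n u).le) T)
      (by
        simp only [hnorm]
        simpa using ha.norm)
    unfold gaussMean
    rw [← key.tsum_eq]
    refine tsum_congr fun n => ?_
    rw [integral_const_mul]
    have := gaussMean_exp (l n) T
    unfold gaussMean at this
    rw [this]
  rw [show gaussMean (fun u => ∑' n, a n * Complex.exp ((l n * u : ℝ) * Complex.I)) = _ from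
    funext h1]
  refine tendsto_tsum_of_dominated_convergence ha.norm (fun n => Tendsto.const_mul _ ?_)
    (Eventually.of_forall fun T n => ?_)
  · split_ifs with hl
    · simp [hl]
    · have hl' : 0 < (l n) ^ 2 := by positivity
      have h2 : Tendsto (fun T : ℝ => Real.exp (-(T * l n) ^ 2 / 2)) atTop (𝓝 0) := by
        refine Real.tendsto_exp_atBot.comp ?_
        have h3 : Tendsto (fun T : ℝ => T ^ 2 * ((l n) ^ 2 / 2)) atTop atTop :=
          (tendsto_pow_atTop two_ne_zero).atTop_mul_const (by positivity)
        refine (tendsto_neg_atTop_atBot.comp h3).congr fun T => ?_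
        simp only [Function.comp_apply]
        ring
      exact (Complex.continuous_ofReal.tendsto' 0 0 rfl).comp h2
  · rw [norm_mul, Complex.norm_real, Real.norm_of_nonneg (Real.exp_pos _).le]
    refine mul_le_of_le_one_right (norm_nonneg _) (Real.exp_le_one_iff.mpr ?_)
    have := sq_nonneg (T * l n)
    linarith

/-- After rescaling, every `v ≠ 0` is sent to infinity, and `v = 0` is a null set. -/
lemma tendsto_gaussMean_zero {g : ℝ → ℂ} (hg : Continuous g) {B : ℝ} (hB : ∀ u, ‖g u‖ ≤ B)
    (h0 : Tendsto g (cocompact ℝ) (𝓝 0)) : Tendsto (gaussMean g) atTop (𝓝 0) := by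
  have h1 : Tendsto (fun T => ∫ v, g (T * v) ∂(gaussianReal 0 1)) atTop
      (𝓝 (∫ _, (0 : ℂ) ∂(gaussianReal 0 1))) := by
    refine tendsto_integral_filter_of_dominated_convergence (fun _ => B)
      (Eventually.of_forall fun T => (hg.comp (continuous_const_mul T)).aestronglyMeasurable)
      (Eventually.of_forall fun T => Eventually.of_forall fun v => hB _) (integrable_const _) ?_
    have : NullSingletonClass (gaussianReal 0 1) := nullSingletonClass_gaussianReal one_ne_zero
    have hne : ∀ᵐ v ∂(gaussianReal 0 1), v ≠ 0 := by
      rw [ae_iff]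
      simp
    filter_upwards [hne] with v hv
    refine h0.comp ?_
    rw [← Metric.cobounded_eq_cocompact, ← tendsto_norm_atTop_iff_cobounded]
    simp only [norm_mul]
    exact (tendsto_norm_atTop_atTop).atTop_mul_const (norm_pos_iff.mpr hv)
  rw [integral_zero] at h1
  exact h1

lemma term_add_ofReal_mul_I (c : ℕ → ℂ) (s : ℂ) (u : ℝ) (n : ℕ) :
    LSeries.term c (s + u * Complex.I) n =
      LSeries.term c s n * Complex.exp ((-Real.log n * u : ℝ) * Complex.I) := by
  rcases eq_or_ne n 0 with rfl | hn
  · simp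
  have hn' : (n : ℂ) ≠ 0 := by exact_mod_cast hn
  rw [LSeries.term_of_ne_zero hn, LSeries.term_of_ne_zero hn, Complex.cpow_add _ _ hn',
    Complex.cpow_def_of_ne_zero hn' (u * Complex.I), Complex.natCast_log.symm,
    show ((-Real.log n * u : ℝ) : ℂ) * Complex.I = -(Real.log n * (u * Complex.I)) by
      push_cast; ring, Complex.exp_neg]
  field_simp

/-- The multipliers `2 - 2 cos (τ log n)` are small for small `τ`, yet nonzero for a given `n ≥ 2`:
both features are needed to recover the coefficients. -/
lemma LSeries_second_difference {c : ℕ → ℂ} {s : ℂ} (hc : LSeriesSummable c s) (τ t : ℝ) :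
    2 * LSeries c (s + t * Complex.I) - LSeries c (s + (t - τ : ℝ) * Complex.I) -
      LSeries c (s + (t + τ : ℝ) * Complex.I) =
    ∑' n, (LSeries.term c s n * (2 - 2 * Real.cos (τ * Real.log n) : ℝ)) *
      Complex.exp ((-Real.log n * t : ℝ) * Complex.I) := by
  have hs : ∀ u : ℝ, Summable fun n => LSeries.term c (s + u * Complex.I) n := fun u =>
    (LSeriesSummable_iff_of_re_eq_re (by simp)).mp hc
  unfold LSeries
  rw [← tsum_mul_left, ← Summable.tsum_sub ((hs t).mul_left 2) (hs _),
    ← Summable.tsum_sub (((hs t).mul_left 2).sub (hs _)) (hs _)]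
  refine tsum_congr fun n => ?_
  simp only [term_add_ofReal_mul_I]
  have e1 : ((-Real.log n * (t - τ) : ℝ) : ℂ) * Complex.I =
    (-Real.log n * t : ℝ) * Complex.I + ((τ * Real.log n : ℝ) : ℂ) * Complex.I := by push_cast; ring
  have e2 : ((-Real.log n * (t + τ) : ℝ) : ℂ) * Complex.I =
    (-Real.log n * t : ℝ) * Complex.I + -((τ * Real.log n : ℝ) : ℂ) * Complex.I := by push_cast; ring
  rw [e1, e2, Complex.exp_add, Complex.exp_add]
  rw [Complex.ofReal_sub, Complex.ofReal_mul 2, Complex.ofReal_cos]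
  have h2 := Complex.two_cos (((τ * Real.log n : ℝ)) : ℂ)
  rw [Complex.ofReal_ofNat, h2]
  ring

lemma continuous_LSeries_vertical {c : ℕ → ℂ} {s : ℂ} (hc : LSeriesSummable c s) :
    Continuous fun t : ℝ => LSeries c (s + t * Complex.I) := by
  unfold LSeries
  simp only [term_add_ofReal_mul_I]
  refine continuous_tsum (fun n => by fun_prop) (Summable.norm hc) fun n t => ?_
  rw [norm_mul, norm_exp_ofReal_mul_ofReal_mul_I, mul_one]

/-- If the second differences of `Im D`, `D` an absolutely convergent Dirichlet series on a
vertical line, vanish asymptotically modulo `π`, then `D` is constant. -/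
lemma coeff_eq_zero_of_tendsto_exp {c : ℕ → ℂ} {s : ℂ} (hc : LSeriesSummable c s)
    (h : ∀ τ : ℝ, Tendsto (secondRatio τ fun t => Complex.exp (LSeries c (s + t * Complex.I) -
      starRingEnd ℂ (LSeries c (s + t * Complex.I)))) (cocompact ℝ) (𝓝 1)) {m : ℕ} (hm : 2 ≤ m) :
    c m = 0 := by
  set a : ℕ → ℂ := LSeries.term c s with ha
  have hlogm : 0 < Real.log m := Real.log_pos (by exact_mod_cast hm)
  have hκ : ∀ τ x : ℝ, 0 ≤ 2 - 2 * Real.cos (τ * x) ∧ 2 - 2 * Real.cos (τ * x) ≤ 4 := fun τ x =>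
    ⟨by linarith [Real.cos_le_one (τ * x)], by linarith [Real.neg_one_le_cos (τ * x)]⟩
  have hnorm : ∀ (τ : ℝ) (n : ℕ), ‖a n * (2 - 2 * Real.cos (τ * Real.log n) : ℝ)‖ =
      ‖a n‖ * (2 - 2 * Real.cos (τ * Real.log n)) := fun τ n => by
    rw [norm_mul, Complex.norm_real, Real.norm_of_nonneg (hκ _ _).1]
  have hbd : ∀ (τ : ℝ) (n : ℕ), ‖a n‖ * (2 - 2 * Real.cos (τ * Real.log n)) ≤ ‖a n‖ * 4 :=
    fun τ n => mul_le_mul_of_nonneg_left (hκ _ _).2 (norm_nonneg _)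
  have hs4 : Summable fun n => ‖a n‖ * 4 := (Summable.norm hc).mul_right 4
  have hsm : ∀ τ : ℝ, Summable fun n => ‖a n‖ * (2 - 2 * Real.cos (τ * Real.log n)) := fun τ =>
    Summable.of_nonneg_of_le (fun n => mul_nonneg (norm_nonneg _) (hκ _ _).1) (hbd τ) hs4
  have hsmall : Tendsto (fun τ : ℝ => ∑' n, ‖a n‖ * (2 - 2 * Real.cos (τ * Real.log n))) (𝓝[>] 0)
      (𝓝 (∑' _ : ℕ, 0)) := by
    refine tendsto_tsum_of_dominated_convergence hs4 (fun n => ?_)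
      (Eventually.of_forall fun τ n => ?_)
    · have : Continuous fun τ : ℝ => ‖a n‖ * (2 - 2 * Real.cos (τ * Real.log n)) := by fun_prop
      exact (this.tendsto' 0 0 (by simp)).mono_left nhdsWithin_le_nhds
    · rw [Real.norm_of_nonneg (mul_nonneg (norm_nonneg _) (hκ _ _).1)]
      exact hbd τ n
  rw [tsum_zero] at hsmall
  -- The first condition keeps the second difference within the principal branch of the logarithm;
  -- the last keeps the multiplier at `m` nonzero.
  have hev : ∀ᶠ τ : ℝ in 𝓝[>] 0, (∑' n, ‖a n‖ * (2 - 2 * Real.cos (τ * Real.log n)) < 1) ∧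
      0 < τ ∧ τ * Real.log m < 2 * Real.pi := by
    refine (hsmall.eventually_lt_const one_pos).and (eventually_mem_nhdsWithin.and ?_)
    have : Continuous fun τ : ℝ => τ * Real.log m := by fun_prop
    exact ((this.tendsto' 0 0 (by simp)).mono_left nhdsWithin_le_nhds).eventually_lt_const
      Real.two_pi_pos
  obtain ⟨τ, hτ1, hτ0, hτ2⟩ := hev.exists
  set b : ℕ → ℂ := fun n => a n * (2 - 2 * Real.cos (τ * Real.log n) : ℝ) with hb
  have hbs : Summable b := by
    apply Summable.of_norm
    simpa only [hb, hnorm] using hsm τ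
  set A : ℝ → ℂ := fun t => ∑' n, b n * Complex.exp ((-Real.log n * t : ℝ) * Complex.I) with hA
  have hAeq : ∀ t : ℝ, 2 * LSeries c (s + t * Complex.I) - LSeries c (s + (t - τ : ℝ) * Complex.I) -
      LSeries c (s + (t + τ : ℝ) * Complex.I) = A t := fun t => LSeries_second_difference hc τ t
  have hAcont : Continuous A := by
    have hD := continuous_LSeries_vertical hc
    have h1 : Continuous fun t : ℝ => LSeries c (s + (t - τ : ℝ) * Complex.I) :=
      hD.comp (continuous_sub_right τ)
    have h2 : Continuous fun t : ℝ => LSeries c (s + (t + τ : ℝ) * Complex.I) :=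
      hD.comp (continuous_add_const τ)
    exact (((hD.const_mul 2).sub h1).sub h2).congr hAeq
  have hAnorm : ∀ t, ‖A t‖ ≤ 1 := by
    intro t
    have h1 : ∀ n, ‖b n * Complex.exp ((-Real.log n * t : ℝ) * Complex.I)‖ =
        ‖a n‖ * (2 - 2 * Real.cos (τ * Real.log n)) := fun n => by
      rw [norm_mul, norm_exp_ofReal_mul_ofReal_mul_I, mul_one, hb, hnorm]
    refine (norm_tsum_le_tsum_norm ?_).trans ?_
    · simpa only [h1] using hsm τ
    · simpa only [h1] using hτ1.le
  set P : ℝ → ℂ := fun t => A t - starRingEnd ℂ (A t) with hP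
  have hPcont : Continuous P := hAcont.sub (Complex.continuous_conj.comp hAcont)
  have hPnorm : ∀ t, ‖P t‖ ≤ 2 := fun t => by
    refine (norm_sub_le _ _).trans ?_
    rw [RCLike.norm_conj]
    linarith [hAnorm t]
  -- Since `|Im P| ≤ 2 < π`, the principal logarithm of `exp P` is `P` itself.
  have hP0 : Tendsto P (cocompact ℝ) (𝓝 0) := by
    have h1 := ((continuousAt_clog (x := 1) (by simp)).tendsto).comp (h τ)
    rw [Complex.log_one] at h1
    refine h1.congr fun t => ?_
    simp only [Function.comp_apply]
    rw [secondRatio_exp]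
    have h2 : 2 * (LSeries c (s + t * Complex.I) - starRingEnd ℂ (LSeries c (s + t * Complex.I))) -
        (LSeries c (s + (t - τ : ℝ) * Complex.I) -
          starRingEnd ℂ (LSeries c (s + (t - τ : ℝ) * Complex.I))) -
        (LSeries c (s + (t + τ : ℝ) * Complex.I) -
          starRingEnd ℂ (LSeries c (s + (t + τ : ℝ) * Complex.I))) = P t := by
      simp only [hP]
      rw [← hAeq]
      simp only [map_sub, map_mul, map_ofNat]
      ring
    rw [h2]
    have h3 := abs_le.mp ((Complex.abs_im_le_norm (P t)).trans (hPnorm t))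
    have := Real.pi_gt_three
    exact Complex.log_exp (by linarith) (by linarith)
  have hmean : Tendsto (gaussMean fun t => P t *
      Complex.exp ((Real.log m * t : ℝ) * Complex.I)) atTop (𝓝 0) := by
    refine tendsto_gaussMean_zero (B := 2) (hPcont.mul (by fun_prop)) (fun t => ?_) ?_
    · rw [norm_mul, norm_exp_ofReal_mul_ofReal_mul_I, mul_one]
      exact hPnorm t
    · rw [tendsto_zero_iff_norm_tendsto_zero] at hP0 ⊢
      refine hP0.congr fun t => ?_
      rw [norm_mul, norm_exp_ofReal_mul_ofReal_mul_I, mul_one]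
  have hbs' : Summable fun n => starRingEnd ℂ (b n) := by
    apply Summable.of_norm
    simpa using hbs.norm
  have t1 := tendsto_gaussMean_tsum hbs fun n => -Real.log n + Real.log m
  have t2 := tendsto_gaussMean_tsum hbs' fun n => Real.log n + Real.log m
  have hv1 : (∑' n, b n * if -Real.log n + Real.log m = 0 then 1 else 0) = b m := by
    rw [tsum_eq_single m]
    · simp
    · intro n hn
      rcases eq_or_ne n 0 with rfl | hn0
      · simp [hb, ha]
      rw [if_neg, mul_zero]
      intro h0
      refine hn ?_
      have := Real.log_injOn_pos (x₁ := n) (x₂ := m)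
        (Set.mem_Ioi.mpr (by exact_mod_cast Nat.pos_of_ne_zero hn0))
        (Set.mem_Ioi.mpr (by exact_mod_cast (by omega : 0 < m))) (by linarith)
      exact_mod_cast this
  -- The conjugate series has frequencies `log n ≥ 0`, so it never meets `-log m < 0`; the
  -- coefficient `b m` is isolated.
  have hv2 : (∑' n, starRingEnd ℂ (b n) * if Real.log n + Real.log m = 0 then 1 else 0) = 0 := by
    refine (tsum_congr fun n => ?_).trans tsum_zero
    have : 0 ≤ Real.log n := Real.log_natCast_nonneg n
    rw [if_neg (by linarith), mul_zero]
  rw [hv1] at t1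
  rw [hv2] at t2
  have e1 : ∀ t : ℝ, (∑' n, b n * Complex.exp (((-Real.log n + Real.log m) * t : ℝ) * Complex.I)) =
      A t * Complex.exp ((Real.log m * t : ℝ) * Complex.I) := by
    intro t
    rw [hA, ← tsum_mul_right]
    refine tsum_congr fun n => ?_
    rw [mul_assoc (b n) (Complex.exp _) (Complex.exp _), ← Complex.exp_add]
    congr 2
    push_cast
    ring
  have e2 : ∀ t : ℝ, (∑' n, starRingEnd ℂ (b n) *
      Complex.exp (((Real.log n + Real.log m) * t : ℝ) * Complex.I)) =
      starRingEnd ℂ (A t) * Complex.exp ((Real.log m * t : ℝ) * Complex.I) := by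
    intro t
    rw [hA, Complex.conj_tsum, ← tsum_mul_right]
    refine tsum_congr fun n => ?_
    rw [map_mul (starRingEnd ℂ) (b n) (Complex.exp _), ← Complex.exp_conj,
      mul_assoc (starRingEnd ℂ (b n)) (Complex.exp _) (Complex.exp _), ← Complex.exp_add]
    congr 2
    rw [map_mul, Complex.conj_ofReal, Complex.conj_I]
    push_cast
    ring
  simp only [e1] at t1
  simp only [e2] at t2
  have t3 := (t1.sub t2).congr (f₂ := gaussMean fun t => P t *
      Complex.exp ((Real.log m * t : ℝ) * Complex.I)) fun T => by
    unfold gaussMean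
    rw [← integral_sub]
    · simp only [hP, sub_mul]
    · refine integrable_gaussian_of_continuous_of_bounded (C := 1)
        (f := fun t => A t * Complex.exp ((Real.log m * t : ℝ) * Complex.I))
        (hAcont.mul (by fun_prop)) (fun t => ?_) T
      rw [norm_mul, norm_exp_ofReal_mul_ofReal_mul_I, mul_one]
      exact hAnorm t
    · refine integrable_gaussian_of_continuous_of_bounded (C := 1)
        (f := fun t => starRingEnd ℂ (A t) * Complex.exp ((Real.log m * t : ℝ) * Complex.I))
        ((Complex.continuous_conj.comp hAcont).mul (by fun_prop)) (fun t => ?_) T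
      rw [norm_mul, norm_exp_ofReal_mul_ofReal_mul_I, mul_one, RCLike.norm_conj]
      exact hAnorm t
  have hbm : b m = 0 := by simpa using tendsto_nhds_unique t3 hmean
  have hcos : Real.cos (τ * Real.log m) ≠ 1 := by
    have hpos := mul_pos hτ0 hlogm
    rw [Ne, Real.cos_eq_one_iff_of_lt_of_lt (by linarith [Real.pi_pos]) hτ2]
    exact hpos.ne'
  have hκ0 : ((2 - 2 * Real.cos (τ * Real.log m) : ℝ) : ℂ) ≠ 0 := by
    exact_mod_cast fun h0 : 2 - 2 * Real.cos (τ * Real.log m) = 0 => hcos (by linarith)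
  have ham : a m = 0 := (mul_eq_zero.mp hbm).resolve_right hκ0
  have hm0 : m ≠ 0 := by omega
  rw [ha, LSeries.term_of_ne_zero hm0, div_eq_zero_iff] at ham
  exact ham.resolve_right (by simp [Complex.cpow_eq_zero_iff, hm0])

/-! ### The bounded quotient, the critical line and the conclusion -/

/-- A quotient of holomorphic functions that is bounded is holomorphic. -/
lemma exists_bounded_quotient {f g : ℂ → ℂ} {U : Set ℂ} (hU : IsOpen U) (hUc : IsPreconnected U)
    (hf : DifferentiableOn ℂ f U) (hg : DifferentiableOn ℂ g U) {C : ℝ}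
    (hfg : ∀ s ∈ U, ‖f s‖ ≤ C * ‖g s‖) (hg0 : ∃ s ∈ U, g s ≠ 0) :
    ∃ H : ℂ → ℂ, DifferentiableOn ℂ H U ∧ (∀ s ∈ U, ‖H s‖ ≤ C) ∧ ∀ s ∈ U, f s = H s * g s := by
  have hga := hg.analyticOnNhd hU
  have hne : ∀ z ∈ U, ∀ᶠ s in 𝓝[≠] z, g s ≠ 0 := by
    intro z hz
    refine (hga z hz).eventually_eq_zero_or_eventually_ne_zero.resolve_left fun h0 => ?_
    obtain ⟨s, hs, hgs⟩ := hg0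
    exact hgs (hga.eqOn_zero_of_preconnected_of_eventuallyEq_zero hUc hz h0 hs)
  have hbd : ∀ s ∈ U, g s ≠ 0 → ‖f s / g s‖ ≤ C := by
    intro s hs hgs
    rw [norm_div, div_le_iff₀ (norm_pos_iff.mpr hgs)]
    exact hfg s hs
  -- Taking the punctured limit at every point gives one global function that equals `f / g` off the
  -- zeros of `g` and its removable extension at them.
  set H : ℂ → ℂ := fun z => limUnder (𝓝[≠] z) fun s => f s / g s with hH
  have hHeq : ∀ s ∈ U, g s ≠ 0 → H s = f s / g s := by
    intro s hs hgs
    have hc : ContinuousAt (fun s => f s / g s) s :=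
      (hf.continuousOn.continuousAt (hU.mem_nhds hs)).div
        (hg.continuousOn.continuousAt (hU.mem_nhds hs)) hgs
    exact (hc.tendsto.mono_left nhdsWithin_le_nhds).limUnder_eq
  have hHd : ∀ z ∈ U, DifferentiableAt ℂ H z := by
    intro z hz
    have h1 : {s | s ≠ z → g s ≠ 0} ∩ U ∈ 𝓝 z :=
      inter_mem (eventually_nhdsWithin_iff.mp (hne z hz)) (hU.mem_nhds hz)
    have h2 := Complex.differentiableOn_update_limUnder_of_bddAbove (f := fun s => f s / g s) h1
      (fun s hs => ((hf.differentiableAt (hU.mem_nhds hs.1.2)).div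
        (hg.differentiableAt (hU.mem_nhds hs.1.2)) (hs.1.1 hs.2)).differentiableWithinAt)
      ⟨C, by
        rintro _ ⟨s, hs, rfl⟩
        exact hbd s hs.1.2 (hs.1.1 hs.2)⟩
    refine (h2.differentiableAt h1).congr_of_eventuallyEq ?_
    filter_upwards [h1] with s hs
    rcases eq_or_ne s z with rfl | hsz
    · simp [hH]
    · rw [Function.update_of_ne hsz, hHeq s hs.2 (hs.1 hsz)]
  refine ⟨H, fun z hz => (hHd z hz).differentiableWithinAt, fun z hz => ?_, fun z hz => ?_⟩
  · refine le_of_tendsto ((hHd z hz).continuousAt.tendsto.mono_left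
      (nhdsWithin_le_nhds (s := {z}ᶜ))).norm ?_
    filter_upwards [hne z hz, nhdsWithin_le_nhds (hU.mem_nhds hz)] with s hs hsU
    rw [hHeq s hsU hs]
    exact hbd s hsU hs
  · by_cases hgz : g z = 0
    · have := hfg z hz
      rw [hgz, norm_zero, mul_zero] at this
      rw [hgz, mul_zero, norm_le_zero_iff.mp this]
    · rw [hHeq z hz hgz, div_mul_cancel₀ _ hgz]

open Selberg in
lemma gammaFactor_conj {r : ℕ} {Q : ℝ} (hQ : 0 < Q) (lam : Fin r → ℝ) (mu : Fin r → ℂ) (s : ℂ) :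
    gammaFactor Q lam (fun j => starRingEnd ℂ (mu j)) (starRingEnd ℂ s) =
      starRingEnd ℂ (gammaFactor Q lam mu s) := by
  unfold gammaFactor
  rw [map_mul, map_prod]
  congr 1
  · rw [Complex.cpow_conj _ _ (by
      rw [Complex.arg_ofReal_of_nonneg hQ.le]; exact Real.pi_ne_zero.symm), Complex.conj_ofReal]
  · refine Finset.prod_congr rfl fun j _ => ?_
    rw [← Complex.Gamma_conj]
    simp

/-- The functional equation on the critical line, with the archimedean factor recorded through its
relevant properties. -/
lemma Selberg.HasFunctionalEquation.critical_line {F : ℂ → ℂ} (hF : HasFunctionalEquation F) :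
    ∃ (X : ℝ → ℂ) (ω : ℂ), ω ≠ 0 ∧ (∀ t, X t ≠ 0) ∧ Continuous X ∧
      (∀ τ, Tendsto (secondRatio τ X) (cocompact ℝ) (𝓝 1)) ∧
      ∀ t : ℝ, X t * F (1 / 2 + t * Complex.I) =
        ω * starRingEnd ℂ (X t) * starRingEnd ℂ (F (1 / 2 + t * Complex.I)) := by
  obtain ⟨r, Q, lam, mu, ω, hQ, hlam, hmu, hω, hfe⟩ := hF
  have hre : ∀ t : ℝ, (1 / 2 + t * Complex.I : ℂ).re = 1 / 2 := fun t => by simp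
  have hpos : ∀ (t : ℝ) (j : Fin r), 0 < ((lam j : ℂ) * (1 / 2 + t * Complex.I) + mu j).re := by
    intro t j
    have := mul_pos (hlam j) (show (0 : ℝ) < 1 / 2 by norm_num)
    simpa using add_pos_of_pos_of_nonneg this (hmu j)
  have hpole : ∀ (z : ℂ) (k : ℕ), 0 < z.re → z ≠ -(k : ℂ) := by
    rintro z k hz rfl
    simp only [Complex.neg_re, Complex.natCast_re] at hz
    have : (0 : ℝ) ≤ k := Nat.cast_nonneg k
    linarith
  refine ⟨fun t => gammaFactor Q lam mu (1 / 2 + t * Complex.I), ω, ?_, fun t => ?_, ?_,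
    fun τ => tendsto_secondRatio_gammaFactor hQ hlam hmu τ, fun t => ?_⟩
  · exact norm_ne_zero_iff.mp (by rw [hω]; exact one_ne_zero)
  · exact gammaFactor_ne_zero hQ hlam hmu (by rw [hre]; norm_num)
  · unfold gammaFactor
    refine Continuous.mul ?_ (continuous_finsetProd _ fun j _ => ?_)
    · exact continuous_const.cpow (by fun_prop) fun t => Or.inl (by simpa using hQ)
    · rw [continuous_iff_continuousAt]
      intro t
      refine ContinuousAt.comp (f := fun t : ℝ => (lam j : ℂ) * (1 / 2 + t * Complex.I) + mu j)
        (Complex.differentiableAt_Gamma _ fun k => hpole _ k (hpos t j)).continuousAt ?_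
      fun_prop
  · have h1 : starRingEnd ℂ (1 / 2 + t * Complex.I : ℂ) = 1 - (1 / 2 + t * Complex.I) := by
      simp only [map_add, map_div₀, map_one, map_ofNat, map_mul, Complex.conj_ofReal,
        Complex.conj_I]
      ring
    have h2 := hfe (1 / 2 + t * Complex.I)
      (fun h => by have := hre t; rw [h] at this; norm_num at this)
      (fun h => by have := hre t; rw [h] at this; norm_num at this)
      (fun j k => hpole _ k (hpos t j))
      (fun j k => hpole _ k (by
        rw [← h1]
        have := hpos t j
        simpa using this))
    rw [h1, sub_sub_cancel, ← h1, gammaFactor_conj hQ] at h2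
    exact h2

lemma continuousOn_LSeries_of_summable {c : ℕ → ℂ} {s₀ : ℂ} (hc : LSeriesSummable c s₀) :
    ContinuousOn (LSeries c) {s | s₀.re ≤ s.re} := by
  refine continuousOn_tsum (fun n => ?_) (Summable.norm hc)
    fun n s hs => LSeries.norm_term_le_of_re_le_re c hs n
  rcases eq_or_ne n 0 with rfl | hn
  · simp only [LSeries.term_zero]
    exact continuousOn_const
  · exact fun s _ => (LSeries.hasDerivAt_term c n s).continuousAt.continuousWithinAt

lemma analyticOnNhd_LSeries_of_summable {c : ℕ → ℂ} {s₀ : ℂ} (hc : LSeriesSummable c s₀) :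
    AnalyticOnNhd ℂ (LSeries c) {s | s₀.re < s.re} :=
  (LSeries_analyticOnNhd c).mono fun s hs =>
    lt_of_le_of_lt hc.abscissaOfAbsConv_le (by exact_mod_cast hs)

/-- If `exp (∑ c(n) n^{-s})`, with `c` supported on prime powers and `c(n) = O(n ^ θ)`, `θ < 1 / 2`,
continues to a bounded holomorphic function on `Re s > 1/2`, then the series `∑ c(n) n^{-1/2}`
converges absolutely. -/
lemma LSeriesSummable_half_of_bounded {c : ArithmeticFunction ℂ} {H : ℂ → ℂ} {C θ K : ℝ}
    (hθ : θ < 1 / 2) (hK : 0 ≤ K) (hb : ∀ n : ℕ, 1 ≤ n → ‖c n‖ ≤ K * (n : ℝ) ^ θ)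
    (hsupp : ∀ n, ¬ IsPrimePow n → c n = 0) (hc : ∀ s : ℂ, 1 < s.re → LSeriesSummable c s)
    (hH : DifferentiableOn ℂ H {s | 1 / 2 < s.re}) (hC : ∀ s : ℂ, 1 / 2 < s.re → ‖H s‖ ≤ C)
    (hexp : ∀ s : ℂ, 1 < s.re → H s = Complex.exp (LSeries c s)) :
    LSeriesSummable c (1 / 2) := by
  have hc2 : LSeriesSummable c 2 := hc 2 (by norm_num)
  have hh : ∀ s : ℂ, 1 < s.re → LSeriesHasSum (dirichletExp c) s (H s) := fun s hs => by
    rw [hexp s hs]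
    exact LSeriesHasSum_dirichletExp (hc s hs)
  refine LSeriesSummable_half_of_prime_pow hθ hK hb hsupp fun k => ?_
  refine summable_term_prime_pow hc2 (hsupp 1 not_isPrimePow_one) (M := 2 * C) (fun k hk S hS => ?_) k
  exact sum_norm_prime_pow_le hH hC hh hk hS fun A hA =>
    dirichletExp_prod_prime_pow hc2 hsupp k A fun p hp => hS p (hA hp)

lemma rpow_bound_sub {b₁ b₂ : ℕ → ℂ} {θ₁ θ₂ K₁ K₂ : ℝ}
    (h₁ : ∀ n : ℕ, 1 ≤ n → ‖b₁ n‖ ≤ K₁ * (n : ℝ) ^ θ₁)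
    (h₂ : ∀ n : ℕ, 1 ≤ n → ‖b₂ n‖ ≤ K₂ * (n : ℝ) ^ θ₂) (n : ℕ) (hn : 1 ≤ n) :
    ‖b₁ n - b₂ n‖ ≤ (|K₁| + |K₂|) * (n : ℝ) ^ max θ₁ θ₂ := by
  have hn' : (1 : ℝ) ≤ n := by exact_mod_cast hn
  refine (norm_sub_le _ _).trans ?_
  rw [add_mul]
  refine add_le_add ((h₁ n hn).trans ?_) ((h₂ n hn).trans ?_)
  · refine mul_le_mul (le_abs_self _) ?_ (by positivity) (abs_nonneg _)
    exact Real.rpow_le_rpow_of_exponent_le hn' (le_max_left _ _)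
  · refine mul_le_mul (le_abs_self _) ?_ (by positivity) (abs_nonneg _)
    exact Real.rpow_le_rpow_of_exponent_le hn' (le_max_right _ _)

/-- If two solutions of functional equations of Riemann type differ on the critical line by the
factor `exp D`, then the second differences of `2 Im D` vanish asymptotically modulo `2π`. -/
lemma tendsto_secondRatio_exp_sub_conj {F G e : ℂ → ℂ} {D : ℝ → ℂ}
    (hF : Selberg.HasFunctionalEquation F) (hG : Selberg.HasFunctionalEquation G)
    (hD : Continuous D)
    (hFG : ∀ t : ℝ, F (1 / 2 + t * Complex.I) = Complex.exp (D t) * G (1 / 2 + t * Complex.I))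
    (he : Differentiable ℂ e) (he0 : ∃ s, e s ≠ 0)
    (heG : ∀ t : ℝ, e (1 / 2 + t * Complex.I) ≠ 0 → G (1 / 2 + t * Complex.I) ≠ 0) (τ : ℝ) :
    Tendsto (secondRatio τ fun t => Complex.exp (D t - starRingEnd ℂ (D t))) (cocompact ℝ)
      (𝓝 1) := by
  obtain ⟨X, ω, hω, hX0, hXc, hXlim, hXF⟩ := hF.critical_line
  obtain ⟨Y, η, hη, hY0, hYc, hYlim, hYG⟩ := hG.critical_line
  have hconj0 : ∀ z : ℂ, z ≠ 0 → starRingEnd ℂ z ≠ 0 := fun z hz => by simpa using hz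
  -- The entire function `e` serves to show that the zeros of `G` on the line are isolated, so
  -- identities obtained by cancelling `G` extend by continuity.
  have hne : ∀ t₀ : ℝ, ∀ᶠ t : ℝ in 𝓝[≠] t₀, e (1 / 2 + t * Complex.I) ≠ 0 := by
    intro t₀
    have hea := he.differentiableOn.analyticOnNhd isOpen_univ
    have h1 : ∀ᶠ s in 𝓝[≠] (1 / 2 + t₀ * Complex.I : ℂ), e s ≠ 0 := by
      refine (hea _ (Set.mem_univ _)).eventually_eq_zero_or_eventually_ne_zero.resolve_left
        fun h0 => ?_
      obtain ⟨s, hs⟩ := he0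
      exact hs (hea.eqOn_zero_of_preconnected_of_eventuallyEq_zero isPreconnected_univ
        (Set.mem_univ _) h0 (Set.mem_univ s))
    have h2 : Tendsto (fun t : ℝ => (1 / 2 + t * Complex.I : ℂ)) (𝓝[≠] t₀)
        (𝓝[≠] (1 / 2 + t₀ * Complex.I : ℂ)) := by
      refine tendsto_nhdsWithin_of_tendsto_nhds_of_eventually_within _ ?_ ?_
      · have : Continuous fun t : ℝ => (1 / 2 + t * Complex.I : ℂ) := by fun_prop
        exact (this.tendsto t₀).mono_left nhdsWithin_le_nhds
      · filter_upwards [eventually_mem_nhdsWithin] with t ht h0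
        refine ht ?_
        have := congrArg Complex.im h0
        simpa using this
    exact h2.eventually h1
  have hid : ∀ t, η * (X t * starRingEnd ℂ (Y t) * Complex.exp (D t)) =
      ω * (starRingEnd ℂ (X t) * Y t * starRingEnd ℂ (Complex.exp (D t))) := by
    intro t₀
    have hL : Continuous fun t => η * (X t * starRingEnd ℂ (Y t) * Complex.exp (D t)) :=
      continuous_const.mul ((hXc.mul (Complex.continuous_conj.comp hYc)).mul
        (Complex.continuous_exp.comp hD))
    have hR : Continuous fun t => ω * (starRingEnd ℂ (X t) * Y t * starRingEnd ℂ (Complex.exp (D t))) :=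
      continuous_const.mul (((Complex.continuous_conj.comp hXc).mul hYc).mul
        (Complex.continuous_conj.comp (Complex.continuous_exp.comp hD)))
    refine tendsto_nhds_unique_of_eventuallyEq (l := 𝓝[≠] t₀)
      ((hL.tendsto t₀).mono_left nhdsWithin_le_nhds)
      ((hR.tendsto t₀).mono_left nhdsWithin_le_nhds) ?_
    filter_upwards [hne t₀] with t ht
    have hG0 := heG t ht
    have e1 := hXF t
    rw [hFG t, map_mul] at e1
    have e2 := hYG t
    have hG0' := hconj0 _ hG0
    generalize G (1 / 2 + t * Complex.I) = g at *
    apply mul_right_cancel₀ (mul_ne_zero hG0 hG0')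
    linear_combination η * starRingEnd ℂ (Y t) * starRingEnd ℂ g * e1 -
      ω * starRingEnd ℂ (X t) * starRingEnd ℂ (Complex.exp (D t)) * starRingEnd ℂ g * e2
  -- Dividing the two functional equations eliminates `G` and leaves only gamma factors and a
  -- constant, to which the second ratio is insensitive.
  have hprod : ∀ t, Complex.exp (D t - starRingEnd ℂ (D t)) * (X t * starRingEnd ℂ (Y t)) =
      (ω / η) * (starRingEnd ℂ (X t) * Y t) := by
    intro t
    rw [Complex.exp_sub, Complex.exp_conj]
    have := hconj0 _ (Complex.exp_ne_zero (D t))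
    field_simp
    linear_combination hid t
  have hSR : ∀ t, secondRatio τ (fun t => Complex.exp (D t - starRingEnd ℂ (D t))) t *
      (secondRatio τ X t * starRingEnd ℂ (secondRatio τ Y t)) =
      starRingEnd ℂ (secondRatio τ X t) * secondRatio τ Y t := by
    intro t
    rw [← secondRatio_conj, ← secondRatio_conj, ← secondRatio_mul, ← secondRatio_mul,
      ← secondRatio_mul, funext hprod, secondRatio_mul,
      secondRatio_const τ (div_ne_zero hω hη), one_mul]
  have hSne : ∀ {Z : ℝ → ℂ}, (∀ t, Z t ≠ 0) → ∀ t, secondRatio τ Z t ≠ 0 := fun hZ t =>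
    div_ne_zero (pow_ne_zero 2 (hZ t)) (mul_ne_zero (hZ _) (hZ _))
  have hc : ∀ {Z : ℝ → ℂ}, Tendsto (secondRatio τ Z) (cocompact ℝ) (𝓝 1) →
      Tendsto (fun t => starRingEnd ℂ (secondRatio τ Z t)) (cocompact ℝ) (𝓝 1) := fun hZ =>
    (Complex.continuous_conj.tendsto' 1 1 (map_one _)).comp hZ
  have hlim := ((hc (hXlim τ)).mul (hYlim τ)).div ((hXlim τ).mul (hc (hYlim τ)))
    (by simp)
  rw [mul_one, div_one] at hlim
  refine hlim.congr fun t => ?_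
  simp only [Pi.div_apply]
  rw [div_eq_iff (mul_ne_zero (hSne hX0 t) (hconj0 _ (hSne hY0 t))), hSR]

theorem theorem3 (F G : ℂ → ℂ)
    (hF : F ∈ Selberg.SelbergClass) (hG : G ∈ Selberg.SelbergClass)
    (hFG : ∃ C : ℝ, ∀ s : ℂ, 1 / 2 < s.re → s ≠ 1 → ‖F s‖ ≤ C * ‖G s‖) :
    ∀ s : ℂ, s ≠ 1 → F s = G s := by
  obtain ⟨-, ⟨m, f₀, ⟨hf₀, -⟩, hf₀F⟩, hFfe, b₁, hb₁, ⟨θ₁, K₁, hθ₁, hK₁⟩, hFexp⟩ := hF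
  obtain ⟨-, ⟨l, g₀, ⟨hg₀, -⟩, hg₀G⟩, hGfe, b₂, hb₂, ⟨θ₂, K₂, hθ₂, hK₂⟩, hGexp⟩ := hG
  obtain ⟨C, hC⟩ := hFG
  -- Each function is multiplied by the other's power of `s - 1`, so that both carry the common
  -- factor `(s - 1) ^ (l + m)`.
  set f : ℂ → ℂ := fun s => (s - 1) ^ l * f₀ s with hf
  set g : ℂ → ℂ := fun s => (s - 1) ^ m * g₀ s with hg
  have hfd : Differentiable ℂ f := by fun_prop
  have hgd : Differentiable ℂ g := by fun_prop
  have hfF : ∀ s, s ≠ 1 → f s = (s - 1) ^ (l + m) * F s := fun s hs => by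
    simp only [hf, ← hf₀F s hs]; ring
  have hgG : ∀ s, s ≠ 1 → g s = (s - 1) ^ (l + m) * G s := fun s hs => by
    simp only [hg, ← hg₀G s hs]; ring
  have hpow : ∀ s : ℂ, s ≠ 1 → (s - 1) ^ (l + m) ≠ 0 := fun s hs =>
    pow_ne_zero _ (sub_ne_zero.mpr hs)
  have hre1 : ∀ s : ℂ, 1 < s.re → s ≠ 1 := by
    rintro s hs rfl
    simp at hs
  have hG0 : ∀ s : ℂ, 1 < s.re → G s ≠ 0 := fun s hs => by
    obtain ⟨L, -, h⟩ := hGexp s hs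
    rw [h]
    exact Complex.exp_ne_zero L
  have hg2 : g 2 ≠ 0 := by
    have h2 : (1 : ℝ) < (2 : ℂ).re := by norm_num
    rw [hgG 2 (hre1 2 h2)]
    exact mul_ne_zero (hpow 2 (hre1 2 h2)) (hG0 2 h2)
  have hUo := isOpen_re_gt (1 / 2)
  have hUc : IsPreconnected {s : ℂ | 1 / 2 < s.re} := (convex_halfSpace_re_gt _).isPreconnected
  have hfg : ∀ s ∈ {s : ℂ | 1 / 2 < s.re}, ‖f s‖ ≤ C * ‖g s‖ := by
    have h1 : ∀ s : ℂ, 1 / 2 < s.re → s ≠ 1 → ‖f s‖ ≤ C * ‖g s‖ := fun s hs hs1 => by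
      rw [hfF s hs1, hgG s hs1, norm_mul, norm_mul, mul_left_comm]
      exact mul_le_mul_of_nonneg_left (hC s hs hs1) (norm_nonneg _)
    intro s hs
    rcases eq_or_ne s 1 with rfl | hs1
    · refine le_of_tendsto_of_tendsto (b := 𝓝[≠] (1 : ℂ))
        ((hfd.continuous.norm.tendsto 1).mono_left nhdsWithin_le_nhds)
        (((hgd.continuous.norm.const_mul C).tendsto 1).mono_left nhdsWithin_le_nhds) ?_
      filter_upwards [nhdsWithin_le_nhds (hUo.mem_nhds hs), eventually_mem_nhdsWithin] with z hz hz1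
      exact h1 z hz hz1
    · exact h1 s hs hs1
  obtain ⟨H, hHd, hHC, hHfg⟩ := exists_bounded_quotient hUo hUc hfd.differentiableOn
    hgd.differentiableOn hfg ⟨2, by norm_num, hg2⟩
  set c : ArithmeticFunction ℂ :=
    ⟨fun n => b₁ n - b₂ n, by simp [hb₁ 0 not_isPrimePow_zero, hb₂ 0 not_isPrimePow_zero]⟩ with hcdef
  have hcb : ∀ n, c n = b₁ n - b₂ n := fun n => rfl
  have hsupp : ∀ n, ¬ IsPrimePow n → c n = 0 := fun n hn => by
    rw [hcb, hb₁ n hn, hb₂ n hn, sub_zero]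
  have hcsum : ∀ s : ℂ, 1 < s.re → LSeriesSummable c s ∧ H s = Complex.exp (LSeries c s) := by
    intro s hs
    obtain ⟨L₁, hL₁, hF1⟩ := hFexp s hs
    obtain ⟨L₂, hL₂, hG1⟩ := hGexp s hs
    have h1 : LSeriesHasSum c s (L₁ - L₂) := hL₁.sub hL₂
    refine ⟨h1.LSeriesSummable, ?_⟩
    have hs1 := hre1 s hs
    have h2 := hHfg s (by simp only [Set.mem_ofPred_eq]; linarith)
    rw [hfF s hs1, hgG s hs1, mul_left_comm, hF1, hG1] at h2
    rw [h1.LSeries_eq, Complex.exp_sub, eq_div_iff (Complex.exp_ne_zero _)]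
    exact (mul_left_cancel₀ (hpow s hs1) h2).symm
  have hhalf : ((1 / 2 : ℂ)).re = 1 / 2 := by norm_num
  have hc : LSeriesSummable c (1 / 2) :=
    LSeriesSummable_half_of_bounded (max_lt hθ₁ hθ₂) (by positivity) (rpow_bound_sub hK₁ hK₂)
      hsupp (fun s hs => (hcsum s hs).1) hHd hHC fun s hs => (hcsum s hs).2
  have hDa := analyticOnNhd_LSeries_of_summable hc
  have hDc := continuousOn_LSeries_of_summable hc
  rw [hhalf] at hDa hDc
  have hHD : Set.EqOn H (fun s => Complex.exp (LSeries c s)) {s | 1 / 2 < s.re} := by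
    refine (hHd.analyticOnNhd hUo).eqOn_of_preconnected_of_eventuallyEq hDa.cexp hUc (z₀ := 2)
      (by norm_num) ?_
    filter_upwards [(isOpen_re_gt 1).mem_nhds (show (2 : ℂ) ∈ {s : ℂ | 1 < s.re} by norm_num)]
      with s hs
    exact (hcsum s hs).2
  have hfgD : Set.EqOn f (fun s => Complex.exp (LSeries c s) * g s) {s | 1 / 2 < s.re} :=
    fun s hs => by rw [hHfg s hs, hHD hs]
  -- Absolute convergence at `1/2` makes the series continuous up to the boundary, so the identity
  -- reaches the critical line.
  have hfgD' : Set.EqOn f (fun s => Complex.exp (LSeries c s) * g s) {s | 1 / 2 ≤ s.re} :=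
    hfgD.of_subset_closure hfd.continuous.continuousOn
      (hDc.cexp.mul hgd.continuous.continuousOn) (fun s (hs : 1 / 2 < s.re) => hs.le)
      (Complex.closure_setOfPred_lt_re (1 / 2)).ge
  have hlre : ∀ t : ℝ, (1 / 2 + t * Complex.I : ℂ).re = 1 / 2 := fun t => by simp
  have hl1 : ∀ t : ℝ, (1 / 2 + t * Complex.I : ℂ) ≠ 1 := fun t h => by
    have := hlre t
    rw [h] at this
    norm_num at this
  have hline : ∀ t : ℝ, F (1 / 2 + t * Complex.I) =
      Complex.exp (LSeries c (1 / 2 + t * Complex.I)) * G (1 / 2 + t * Complex.I) := by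
    intro t
    have h1 := hfgD' (show (1 / 2 + t * Complex.I : ℂ) ∈ {s : ℂ | 1 / 2 ≤ s.re} from (hlre t).ge)
    simp only at h1
    rw [hfF _ (hl1 t), hgG _ (hl1 t), mul_left_comm] at h1
    exact mul_left_cancel₀ (hpow _ (hl1 t)) h1
  have hc0 : ∀ n : ℕ, n ≠ 0 → c n = 0 := by
    intro n hn
    rcases eq_or_ne n 1 with rfl | hn1
    · exact hsupp 1 not_isPrimePow_one
    refine coeff_eq_zero_of_tendsto_exp hc (fun τ => ?_) (by omega)
    exact tendsto_secondRatio_exp_sub_conj hFfe hGfe (continuous_LSeries_vertical hc) hline hgd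
      ⟨2, hg2⟩ (fun t ht h0 => ht (by rw [hgG _ (hl1 t), h0, mul_zero])) τ
  have hL0 : ∀ s, LSeries c s = 0 := fun s => by
    rw [LSeries_congr (g := 0) (fun {n} hn => hc0 n hn), LSeries_zero, Pi.zero_apply]
  have hfgU : f = g := by
    refine (hfd.differentiableOn.analyticOnNhd isOpen_univ).eq_of_eventuallyEq (z₀ := 2)
      (hgd.differentiableOn.analyticOnNhd isOpen_univ) ?_
    filter_upwards [hUo.mem_nhds (show (2 : ℂ) ∈ {s : ℂ | 1 / 2 < s.re} by norm_num)] with s hs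
    have h1 := hfgD hs
    simp only at h1
    rw [h1, hL0, Complex.exp_zero, one_mul]
  intro s hs
  have := congrFun hfgU s
  rw [hfF s hs, hgG s hs] at this
  exact mul_left_cancel₀ (hpow s hs) this
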